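/- **Model.** Let $n,m\ge 1$ and $\lambda>0$. For each $k\ge n+m$ consider $k$ first-come-first-served, unit-speed servers with infinite buffers. Batches of $n$ jobs arrive according to a Poisson process of intensity $\lambda k/n$. Each batch is coded into $n+m$ jobs, which are sent to $n+m$ queues chosen uniformly at random without replacement; all service requirements are independent exponentials of rate $1$. As soon as any $n$ coded jobs of a batch are completed, its remaining $m$ jobs are removed from the system, including those in service. Suppose that for each $k$ the system is stationary: the vector $(W_1,\dots,W_k)$ of workloads (the workload of a queue is the time to empty it if there were no more arrivals) has the same law at successive batch arrivals. Let $T_i=W_i+E_i$, with $E_i$ independent exponentials of rate $1$ that are also independent of the workloads, be the completion time of a virtual job at queue $i$ that is subject to neither coding nor removal. **Assumption (asymptotic independence).** As $k\to\infty$, for all distinct $i_1,\dots,i_{n+m}\le k$ the joint law of $(T_{i_1},\dots,T_{i_{n+m}})$ and the product of the laws of $T_{i_1},\dots,T_{i_{n+m}}$ become indistinguishable: for every bounded continuous function the difference of the two integrals tends to $0$, uniformly in $i_1,\dots,i_{n+m}$. Let $V$ be a real random variable that is the limit in distribution of $T_i$ as $k\to\infty$ (uniformly in $i$). **Theorem.**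 Under this assumption, with $\alpha=\lambda(m+n)/n$: 1. For all $t\ge 0$ (with the right derivative at $t=0$), $$\frac{d P(V>t)}{dt}=-P(V>t)+\alpha(n+m-1)\binom{n+m-2}{n-1}\sum_{i=0}^{n-1}\binom{n-1}{i}(-1)^i\frac{1}{(m+i)(m+i+1)}\bigl(P(V>t)\bigr)^{m+i+1}.$$ 2. $\limsup_{t\to\infty}e^{t}P(V>t)<\infty$. 3. As $k\to\infty$ the completion time of a batch converges in distribution, with convergence of $P(\cdot>t)$ for every $t$, to a random variable $C_{n,m}$ that has the law of the $n$-th smallest of $n+m$ independent copies of $V$, and for all $t$ $$P(C_{n,m}>t)=(n+m)\binom{n+m-1}{n-1}\sum_{i=0}^{n-1}\binom{n-1}{i}(-1)^i\frac{1}{m+i+1}\bigl(P(V>t)\bigr)^{m+i+1}.$$ 4. $\limsup_{t\to\infty}e^{(m+1)t}P(C_{n,m}>t)<\infty$. 5. For every integer $d$ with $2\le d\le m$, the tail of $C_{n,m}$ is of smaller order than the tail of the completion time of a batch of $n$ jobs under replication at $d$ queues with redundant removal: $$P(C_{n,m}>t)=o\!\left(1-\Bigl(1-\Bigl(\tfrac{1}{\lambda+(1-\lambda)e^{t(d-1)}}\Bigr)^{d/(d-1)}\Bigr)^{n}\right)\qquad(t\to\infty).$$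 -/

import Mathlib

/-
A virtual job at a queue that it finds with workload `W` departs at unit rate once `W` has been
served, so `P (s < V ≤ t) = ∫ u in s..t, (P (V > u) - P (W > u))`. Stationarity gives
`P (W > u)` by balancing the work that a batch adds above level `u` against the unit rate at which a
queue above that level is drained: the coded job `j` adds work above `u` at the times at which its
virtual copy is in service and fewer than `n` other jobs of the batch are done. By the memoryless
property this work is, in expectation, the number of service completions above `u` among the first
`n` of the batch, whence `P (W > u) = (lam / n) * ∑ c < n, P (at most c of the n + m virtual
completion times are ≤ u)`. Asymptotic independence turns the summands into binomial tails in
`P (V > u)`, whose sum is the polynomial in the differential equation.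

That polynomial vanishes to order at least two at zero, so the linear term `-P (V > t)` wins and
the tail decays like `exp (-t)`. The completion time of a batch exceeds `t` when at least `m + 1` of
`n + m` independent copies of `V` do, which has order `P (V > t) ^ (m + 1)`, whereas the replication
tail is at least of order `exp (-d * t)`, with `d < m + 1`. Here `lam < 1`, since for `lam ≥ 1` the
equation keeps a tail that starts at one from decreasing to zero.
-/

open MeasureTheory ProbabilityTheory Filter Topology Set Asymptotics
open scoped BoundedContinuousFunction ENNReal

noncomputable section

namespace MDSQueue

/-- The `n`-th smallest of the numbers `x j`: the first time at which at least `n` of the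
events with epochs `x j` have happened. -/
def orderStat {N : ℕ} (n : ℕ) (x : Fin N → ℝ) : ℝ :=
  sInf {t : ℝ | n ≤ (Finset.univ.filter fun j => x j ≤ t).card}

/-- A batch arrives, finds the workloads `w` in the `k` queues (the workload of a queue is the time
to empty it if there were no more arrivals), and its coded jobs `j`, with service requirements
`e j`, go to the queues `σ j`. Under first-come-first-served, job `j` would be completed, if it were
never removed, at time `w (σ j) + e j` after its arrival. The batch is complete as soon as `n` of
its coded jobs are. -/
def completionTime {k N : ℕ} (n : ℕ) (w : Fin k → ℝ) (σ : Fin N → Fin k) (e : Fin N → ℝ) : ℝ :=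
  orderStat n fun j => w (σ j) + e j

/-- The amount of service that coded job `j` receives. It enters service at time `w (σ j)` and
leaves at its own completion or at the completion of the batch, whichever is first; it is removed
without any service if the batch is completed before it enters service. -/
def receivedService {k N : ℕ} (n : ℕ) (w : Fin k → ℝ) (σ : Fin N → Fin k) (e : Fin N → ℝ)
    (j : Fin N) : ℝ :=
  max 0 (min (e j) (completionTime n w σ e - w (σ j)))

/-- The workloads just after the arrival of the batch. -/
def workloadAfter {k N : ℕ} (n : ℕ) (w : Fin k → ℝ) (σ : Fin N → Fin k) (e : Fin N → ℝ) :
    Fin k → ℝ :=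
  fun q => w q + ∑ j ∈ Finset.univ.filter (fun j => σ j = q), receivedService n w σ e j

/-- The workloads found by the next batch, which arrives `a` time units later
(each server works at unit speed while its queue is nonempty). -/
def nextWorkload {k N : ℕ} (n : ℕ) (w : Fin k → ℝ) (σ : Fin N → Fin k) (e : Fin N → ℝ) (a : ℝ) :
    Fin k → ℝ :=
  fun q => max 0 (workloadAfter n w σ e q - a)

/-- Joint law of the workloads found by an arriving batch (law `π`), of the `N` queues chosen
uniformly at random without replacement, and of the i.i.d. unit-rate exponential service
requirements; the three are independent. -/
def arrivalLaw {k : ℕ} (N : ℕ) (π : Measure (Fin k → ℝ)) :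
    Measure ((Fin k → ℝ) × (Fin N → Fin k) × (Fin N → ℝ)) :=
  π.prod ((uniformOn {σ : Fin N → Fin k | Function.Injective σ}).prod
    (Measure.pi fun _ : Fin N => expMeasure 1))

/-- One step of the Markov chain of the workloads found by successive batches. Batches form a
Poisson process of intensity `lam * k / n`, i.e. the interarrival times are independent
exponentials of that rate. -/
def stepLaw {k : ℕ} (n m : ℕ) (lam : ℝ) (π : Measure (Fin k → ℝ)) : Measure (Fin k → ℝ) :=
  ((arrivalLaw (n + m) π).prod (expMeasure (lam * k / n))).map
    fun p => nextWorkload n p.1.1 p.1.2.1 p.1.2.2 p.2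

/-- `π` is a stationary law of the workloads found by arriving batches in the system with `k`
queues. -/
structure IsStationary {k : ℕ} (n m : ℕ) (lam : ℝ) (π : Measure (Fin k → ℝ)) : Prop where
  isProbabilityMeasure : IsProbabilityMeasure π
  nonneg : ∀ᵐ w ∂π, ∀ q, 0 ≤ w q
  invariant : stepLaw n m lam π = π

/-- Law of the completion time of a batch that finds workloads with law `π`. -/
def completionLaw {k : ℕ} (n m : ℕ) (π : Measure (Fin k → ℝ)) : Measure ℝ :=
  (arrivalLaw (n + m) π).map fun p => completionTime n p.1 p.2.1 p.2.2

/-- Law of the completion time `T i = W i + E i` of a virtual job at queue `i` that is subject to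
neither coding nor removal. -/
def virtualLaw {k : ℕ} (π : Measure (Fin k → ℝ)) (i : Fin k) : Measure ℝ :=
  (π.prod (expMeasure 1)).map fun p => p.1 i + p.2

/-- Joint law of the completion times `T (ι j) = W (ι j) + E j` of virtual jobs at the queues
`ι j`, with independent service requirements `E j`. -/
def jointVirtualLaw {k N : ℕ} (π : Measure (Fin k → ℝ)) (ι : Fin N → Fin k) :
    Measure (Fin N → ℝ) :=
  (π.prod (Measure.pi fun _ : Fin N => expMeasure 1)).map fun p j => p.1 (ι j) + p.2 j

/-- Asymptotic independence of the queues: as the number `k` of queues grows, the joint law of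
the virtual completion times at any `N` distinct queues and the product of their
laws become indistinguishable by bounded continuous functions. -/
def AsymptoticallyIndependent (N : ℕ) (π : (k : ℕ) → Measure (Fin k → ℝ)) : Prop :=
  ∀ f : (Fin N → ℝ) →ᵇ ℝ, ∀ ε > 0, ∀ᶠ k : ℕ in atTop,
    ∀ ι : Fin N → Fin k, Function.Injective ι →
      |∫ x, f x ∂(jointVirtualLaw (π k) ι)
        - ∫ x, f x ∂(Measure.pi fun j => virtualLaw (π k) (ι j))| < ε

/-- `ν` is the law of the virtual waiting time in the limit of many queues: the virtual completion
time at a queue converges in distribution to `ν`, whichever queue it is. -/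
def IsLimitVirtualLaw (π : (k : ℕ) → Measure (Fin k → ℝ)) (ν : Measure ℝ) : Prop :=
  ∀ f : ℝ →ᵇ ℝ, ∀ ε > 0, ∀ᶠ k : ℕ in atTop, ∀ i : Fin k,
    |∫ x, f x ∂(virtualLaw (π k) i) - ∫ x, f x ∂ν| < ε

/-- Tail `P (R > t)` of the completion time of a batch of `n` jobs when each job is replicated at
`d ≥ 2` queues, with removal of the redundant copies, in the limit of many queues. -/
def replicationTail (lam : ℝ) (n d : ℕ) (t : ℝ) : ℝ :=
  1 - (1 - (1 / (lam + (1 - lam) * Real.exp (t * ((d : ℝ) - 1)))) ^ ((d : ℝ) / ((d : ℝ) - 1))) ^ n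

end MDSQueue

end

namespace MDSQueue

/-! ### Binomial tails -/

/-- The probability that fewer than `c` of `M` independent events of probability `1 - x` happen. -/
noncomputable def binomTail (M c : ℕ) (x : ℝ) : ℝ :=
  ∑ a ∈ Finset.range c, (M.choose a : ℝ) * (1 - x) ^ a * x ^ (M - a)

/-- The incomplete beta integral `∫ y in 0..x, y ^ r * (1 - y) ^ (n - 1)` for `n ≥ 1`, expanded. -/
noncomputable def incompleteBeta (n r : ℕ) (x : ℝ) : ℝ :=
  ∑ i ∈ Finset.range n,
    ((n - 1).choose i : ℝ) * (-1) ^ i * (1 / ((r : ℝ) + i + 1)) * x ^ (r + i + 1)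

/-- For `n, m ≥ 1`, the antiderivative of `binomTail (n + m - 1) n` that vanishes at `0`, expanded;
it is the nonlinearity of the differential equation for the limiting tail. -/
noncomputable def binomTailPrimitive (n m : ℕ) (x : ℝ) : ℝ :=
  ((n : ℝ) + m - 1) * ((n + m - 2).choose (n - 1) : ℝ)
    * ∑ i ∈ Finset.range n, ((n - 1).choose i : ℝ) * (-1) ^ i
      * (1 / (((m : ℝ) + i) * ((m : ℝ) + i + 1))) * x ^ (m + i + 1)

lemma eq_of_hasDerivAt_eq {f g f' : ℝ → ℝ} {a : ℝ} (hf : ∀ x, HasDerivAt f (f' x) x)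
    (hg : ∀ x, HasDerivAt g (f' x) x) (h : f a = g a) : f = g := by
  refine eq_of_fderiv_eq (𝕜 := ℝ) (fun x => (hf x).differentiableAt)
    (fun x => (hg x).differentiableAt) (fun x => ?_) a h
  rw [(hf x).hasFDerivAt.fderiv, (hg x).hasFDerivAt.fderiv]

open Polynomial in
lemma derivative_sum_bernsteinPolynomial (M c : ℕ) :
    derivative (∑ a ∈ Finset.range (c + 1), bernsteinPolynomial ℝ M a)
      = -(M : ℝ[X]) * bernsteinPolynomial ℝ (M - 1) c := by
  induction c with
  | zero => simp [bernsteinPolynomial.derivative_zero]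
  | succ c ih =>
    rw [Finset.sum_range_succ, derivative_add, ih, bernsteinPolynomial.derivative_succ]
    ring

lemma binomTail_eq_eval_sum_bernsteinPolynomial (M c : ℕ) (x : ℝ) :
    binomTail M c x
      = (∑ a ∈ Finset.range c, bernsteinPolynomial ℝ M a).eval (1 - x) := by
  simp [binomTail, Polynomial.eval_finsetSum, bernsteinPolynomial]

lemma hasDerivAt_binomTail_succ (M c : ℕ) (x : ℝ) :
    HasDerivAt (binomTail M (c + 1))
      ((M : ℝ) * ((M - 1).choose c * (1 - x) ^ c * x ^ (M - 1 - c))) x := by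
  have h := ((∑ a ∈ Finset.range (c + 1), bernsteinPolynomial ℝ M a).hasDerivAt (1 - x)).comp x
    ((hasDerivAt_id x).const_sub 1)
  rw [derivative_sum_bernsteinPolynomial] at h
  rw [funext (binomTail_eq_eval_sum_bernsteinPolynomial M (c + 1))]
  exact h.congr_deriv (by simp [bernsteinPolynomial])

lemma continuous_binomTail (M c : ℕ) : Continuous (binomTail M c) := by
  unfold binomTail; fun_prop

lemma binomTail_zero {M c : ℕ} (h : c ≤ M) : binomTail M c 0 = 0 := by
  refine Finset.sum_eq_zero fun a ha => ?_
  have : M - a ≠ 0 := by have := Finset.mem_range.1 ha; omega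
  simp [this]

lemma binomTail_one {M c : ℕ} (h : 1 ≤ c) : binomTail M c 1 = 1 := by
  refine (Finset.sum_eq_single_of_mem 0 (Finset.mem_range.2 h) fun b _ hb => ?_).trans ?_ <;>
    simp [*]

lemma binomTail_le_one (M c : ℕ) {x : ℝ} (h0 : 0 ≤ x) (h1 : x ≤ 1) : binomTail M c x ≤ 1 := by
  rcases Nat.eq_zero_or_pos c with rfl | hc
  · simp [binomTail]
  · obtain ⟨c, rfl⟩ := Nat.exists_eq_add_of_le' hc
    have hmono : MonotoneOn (binomTail M (c + 1)) (Icc 0 1) :=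
      monotoneOn_of_hasDerivWithinAt_nonneg (convex_Icc 0 1) (continuous_binomTail _ _).continuousOn
        (fun y _ => (hasDerivAt_binomTail_succ M c y).hasDerivWithinAt) fun y hy => by
          rw [interior_Icc] at hy
          have := sub_nonneg.2 hy.2.le
          have := hy.1.le
          positivity
    exact (hmono ⟨h0, h1⟩ (right_mem_Icc.2 zero_le_one) h1).trans_eq (binomTail_one hc)

lemma hasDerivAt_incompleteBeta_succ (n r : ℕ) (x : ℝ) :
    HasDerivAt (incompleteBeta (n + 1) r) (x ^ r * (1 - x) ^ n) x := by
  have h : HasDerivAt (incompleteBeta (n + 1) r)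
      (∑ i ∈ Finset.range (n + 1), (n.choose i : ℝ) * (-1) ^ i * x ^ (r + i)) x := by
    refine HasDerivAt.fun_sum fun i _ => ?_
    refine ((hasDerivAt_pow (r + i + 1) x).const_mul
      ((n.choose i : ℝ) * (-1) ^ i * (1 / ((r : ℝ) + i + 1)))).congr_deriv ?_
    have : (r : ℝ) + i + 1 ≠ 0 := by positivity
    push_cast
    field_simp
  refine h.congr_deriv ?_
  rw [sub_eq_neg_add, add_pow, Finset.mul_sum]
  refine Finset.sum_congr rfl fun i _ => ?_
  rw [neg_pow x i]
  ring

lemma binomTail_eq_incompleteBeta {n : ℕ} (hn : 1 ≤ n) (r : ℕ) (x : ℝ) :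
    binomTail (n + r) n x
      = ((n : ℝ) + r) * ((n + r - 1).choose (n - 1) : ℝ) * incompleteBeta n r x := by
  obtain ⟨n, rfl⟩ := Nat.exists_eq_add_of_le' hn
  refine congrFun (eq_of_hasDerivAt_eq (a := 0) (hasDerivAt_binomTail_succ (n + 1 + r) n)
    (fun y => ((hasDerivAt_incompleteBeta_succ n r y).const_mul _).congr_deriv ?_) ?_) x
  · rw [show n + 1 + r - 1 - n = r by omega]
    push_cast
    ring_nf
  · simp [binomTail_zero, incompleteBeta]

lemma hasDerivAt_binomTailPrimitive {n m : ℕ} (hn : 1 ≤ n) (hm : 1 ≤ m) (x : ℝ) :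
    HasDerivAt (binomTailPrimitive n m) (binomTail (n + m - 1) n x) x := by
  obtain ⟨r, rfl⟩ := Nat.exists_eq_add_of_le' hm
  rw [show n + (r + 1) - 1 = n + r by omega, binomTail_eq_incompleteBeta hn, incompleteBeta]
  unfold binomTailPrimitive
  rw [show n + (r + 1) - 2 = n + r - 1 by omega]
  refine ((HasDerivAt.fun_sum fun i _ => (hasDerivAt_pow (r + 1 + i + 1) x).const_mul
    (((n - 1).choose i : ℝ) * (-1) ^ i * (1 / (((r + 1 : ℕ) + (i : ℝ))
      * ((r + 1 : ℕ) + (i : ℝ) + 1))))).const_mul _).congr_deriv ?_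
  rw [show (n : ℝ) + (r + 1 : ℕ) - 1 = n + r by push_cast; ring]
  congr 1
  refine Finset.sum_congr rfl fun i _ => ?_
  have h1 : (r : ℝ) + 1 + i + 1 ≠ 0 := by positivity
  have h2 : (r : ℝ) + 1 + i ≠ 0 := by positivity
  have h3 : (r : ℝ) + i + 1 ≠ 0 := by positivity
  rw [show r + 1 + i + 1 - 1 = r + i + 1 by omega]
  push_cast
  field_simp
  ring

lemma binomTailPrimitive_zero (n m : ℕ) : binomTailPrimitive n m 0 = 0 := by
  simp [binomTailPrimitive]

lemma continuous_binomTailPrimitive (n m : ℕ) : Continuous (binomTailPrimitive n m) := by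
  unfold binomTailPrimitive; fun_prop

lemma sum_binomTail_succ_eq {n m : ℕ} (hn : 1 ≤ n) (hm : 1 ≤ m) (x : ℝ) :
    ∑ c ∈ Finset.range n, binomTail (n + m) (c + 1) x
      = ((n : ℝ) + m) * binomTailPrimitive n m x := by
  refine congrFun (eq_of_hasDerivAt_eq (a := 0)
    (fun y => HasDerivAt.fun_sum fun c _ => hasDerivAt_binomTail_succ (n + m) c y)
    (fun y => ((hasDerivAt_binomTailPrimitive hn hm y).const_mul _).congr_deriv ?_) ?_) x
  · rw [binomTail, ← Finset.mul_sum]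
    push_cast
    rfl
  · rw [binomTailPrimitive_zero, mul_zero]
    exact Finset.sum_eq_zero fun c hc =>
      binomTail_zero (by have := Finset.mem_range.1 hc; omega)

lemma binomTailPrimitive_one {n m : ℕ} (hn : 1 ≤ n) (hm : 1 ≤ m) :
    binomTailPrimitive n m 1 = n / ((n : ℝ) + m) := by
  rw [eq_div_iff (by positivity), mul_comm, ← sum_binomTail_succ_eq hn hm]
  simp [binomTail_one]

lemma div_sub_one_sub_le_binomTailPrimitive {n m : ℕ} (hn : 1 ≤ n) (hm : 1 ≤ m) {x : ℝ} (h0 : 0 ≤ x)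
    (h1 : x ≤ 1) : n / ((n : ℝ) + m) - (1 - x) ≤ binomTailPrimitive n m x := by
  have h : binomTailPrimitive n m 1 - binomTailPrimitive n m x ≤ 1 * (1 - x) :=
    (convex_Icc 0 1).image_sub_le_mul_sub_of_deriv_le
      (continuous_binomTailPrimitive n m).continuousOn
      (fun y _ => (hasDerivAt_binomTailPrimitive hn hm y).differentiableAt.differentiableWithinAt)
      (fun y hy => by
        rw [interior_Icc] at hy
        rw [(hasDerivAt_binomTailPrimitive hn hm y).deriv]
        exact binomTail_le_one _ _ hy.1.le hy.2.le)
      x ⟨h0, h1⟩ 1 ⟨zero_le_one, le_rfl⟩ h1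
  rw [binomTailPrimitive_one hn hm] at h
  linarith

lemma sum_mul_pow_le (n r : ℕ) (c : ℕ → ℝ) {x : ℝ} (h0 : 0 ≤ x) (h1 : x ≤ 1) :
    ∑ i ∈ Finset.range n, c i * x ^ (r + i) ≤ (∑ i ∈ Finset.range n, |c i|) * x ^ r := by
  rw [Finset.sum_mul]
  refine Finset.sum_le_sum fun i _ => ?_
  gcongr ?_ * ?_
  · exact le_abs_self _
  · exact pow_le_pow_of_le_one h0 h1 (Nat.le_add_right r i)

lemma exists_binomTail_le {n : ℕ} (hn : 1 ≤ n) (r : ℕ) :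
    ∃ K : ℝ, 0 ≤ K ∧ ∀ x, 0 ≤ x → x ≤ 1 → binomTail (n + r) n x ≤ K * x ^ (r + 1) := by
  refine ⟨((n : ℝ) + r) * ((n + r - 1).choose (n - 1) : ℝ) * ∑ i ∈ Finset.range n,
    |((n - 1).choose i : ℝ) * (-1) ^ i * (1 / ((r : ℝ) + i + 1))|, by positivity,
    fun x h0 h1 => ?_⟩
  rw [binomTail_eq_incompleteBeta hn, mul_assoc (_ * _), incompleteBeta]
  gcongr
  simp_rw [add_right_comm r _ 1]
  exact sum_mul_pow_le n (r + 1) _ h0 h1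

lemma exists_binomTailPrimitive_le_sq {n m : ℕ} (hn : 1 ≤ n) (hm : 1 ≤ m) :
    ∃ K : ℝ, 0 ≤ K ∧ ∀ x, 0 ≤ x → x ≤ 1 → binomTailPrimitive n m x ≤ K * x ^ 2 := by
  have hc : (0 : ℝ) ≤ (n : ℝ) + m - 1 := by
    have : (1 : ℝ) ≤ n := by exact_mod_cast hn
    linarith [Nat.cast_nonneg (α := ℝ) m]
  refine ⟨((n : ℝ) + m - 1) * ((n + m - 2).choose (n - 1) : ℝ) * ∑ i ∈ Finset.range n,
    |((n - 1).choose i : ℝ) * (-1) ^ i * (1 / (((m : ℝ) + i) * ((m : ℝ) + i + 1)))|,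
    by positivity, fun x h0 h1 => ?_⟩
  rw [mul_assoc (_ * _), binomTailPrimitive]
  gcongr
  simp_rw [add_right_comm m _ 1]
  exact (sum_mul_pow_le n (m + 1) _ h0 h1).trans
    (mul_le_mul_of_nonneg_left (pow_le_pow_of_le_one h0 h1 (by omega)) (by positivity))

/-! ### Linear differential inequalities -/

lemma antitoneOn_exp_mul {A A' H H' : ℝ → ℝ} {T : ℝ} (hA : ∀ t, T ≤ t → HasDerivAt A (A' t) t)
    (hH : ∀ t, T ≤ t → HasDerivWithinAt H (H' t) (Ici T) t)
    (hle : ∀ t, T ≤ t → A' t * H t + H' t ≤ 0) :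
    AntitoneOn (fun t => Real.exp (A t) * H t) (Ici T) := by
  have hderiv : ∀ t ∈ Ici T, HasDerivWithinAt (fun t => Real.exp (A t) * H t)
      (Real.exp (A t) * (A' t * H t + H' t)) (Ici T) t := fun t ht =>
    ((hA t ht).hasDerivWithinAt.exp.mul (hH t ht)).congr_deriv (by ring)
  refine antitoneOn_of_hasDerivWithinAt_nonpos (convex_Ici T)
    (fun t ht => (hderiv t ht).continuousWithinAt)
    (fun t ht => (hderiv t (interior_subset ht)).mono interior_subset) fun t ht =>
      mul_nonpos_of_nonneg_of_nonpos (Real.exp_pos _).le (hle t (interior_subset ht))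

lemma exists_le_exp_neg_half {H H' : ℝ → ℝ} {K : ℝ}
    (hH : ∀ t, 0 ≤ t → HasDerivWithinAt H (H' t) (Ici 0) t) (hH0 : ∀ t, 0 ≤ H t)
    (hlim : Tendsto H atTop (𝓝 0)) (hle : ∀ t, 0 ≤ t → H' t ≤ -H t + K * H t ^ 2) :
    ∃ T c : ℝ, 0 ≤ T ∧ 0 ≤ c ∧ ∀ t, T ≤ t → H t ≤ c * Real.exp (-t / 2) := by
  obtain ⟨T, hT0, hT⟩ : ∃ T : ℝ, 0 ≤ T ∧ ∀ t, T ≤ t → K * H t ≤ 1 / 2 := by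
    have h := (hlim.const_mul K).eventually
      (ge_mem_nhds (show K * 0 < 1 / 2 by rw [mul_zero]; norm_num))
    obtain ⟨T, hT⟩ := eventually_atTop.1 h
    exact ⟨max T 0, le_max_right _ _, fun t ht => hT t ((le_max_left _ _).trans ht)⟩
  have hanti : AntitoneOn (fun t => Real.exp (t / 2) * H t) (Ici T) :=
    antitoneOn_exp_mul (fun t _ => (hasDerivAt_id t).div_const 2)
      (fun t ht => (hH t (hT0.trans ht)).mono (Ici_subset_Ici.2 hT0)) fun t ht => by
        have := mul_le_mul_of_nonneg_right (hT t ht) (hH0 t)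
        linarith [hle t (hT0.trans ht)]
  refine ⟨T, Real.exp (T / 2) * H T, hT0, mul_nonneg (Real.exp_pos _).le (hH0 T), fun t ht => ?_⟩
  rw [neg_div, Real.exp_neg, ← div_eq_mul_inv, le_div_iff₀ (Real.exp_pos _), mul_comm]
  exact hanti self_mem_Ici ht ht

lemma exists_exp_mul_le_of_deriv_le {H H' : ℝ → ℝ} {K : ℝ} (hK : 0 ≤ K)
    (hH : ∀ t, 0 ≤ t → HasDerivWithinAt H (H' t) (Ici 0) t) (hH0 : ∀ t, 0 ≤ H t)
    (hlim : Tendsto H atTop (𝓝 0)) (hle : ∀ t, 0 ≤ t → H' t ≤ -H t + K * H t ^ 2) :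
    ∃ C, ∀ᶠ t in atTop, Real.exp t * H t ≤ C := by
  obtain ⟨T, c, hT0, hc, hT⟩ := exists_le_exp_neg_half hH hH0 hlim hle
  -- `A' = 1 - K c e^{-t/2}` and `K H ≤ K c e^{-t/2}`, so `A' H + H' ≤ 0`; and `t ≤ A t`.
  let A : ℝ → ℝ := fun t => t + 2 * (K * c) * Real.exp (-t / 2)
  have hA : ∀ t, HasDerivAt A (1 - K * c * Real.exp (-t / 2)) t := fun t =>
    ((hasDerivAt_id t).add
      (((hasDerivAt_neg t).div_const 2).exp.const_mul (2 * (K * c)))).congr_deriv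
      (by ring)
  have hanti : AntitoneOn (fun t => Real.exp (A t) * H t) (Ici T) :=
    antitoneOn_exp_mul (fun t _ => hA t)
      (fun t ht => (hH t (hT0.trans ht)).mono (Ici_subset_Ici.2 hT0)) fun t ht => by
        have := mul_le_mul_of_nonneg_left (mul_le_mul_of_nonneg_left (hT t ht) (hH0 t)) hK
        linarith [hle t (hT0.trans ht)]
  refine ⟨Real.exp (A T) * H T, ?_⟩
  filter_upwards [eventually_ge_atTop T] with t ht
  refine le_trans ?_ (hanti self_mem_Ici ht ht)
  exact mul_le_mul_of_nonneg_right
    (Real.exp_le_exp.2 (le_add_of_nonneg_right (by positivity))) (hH0 t)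

lemma eq_one_of_le_deriv {H H' : ℝ → ℝ} {α : ℝ}
    (hH : ∀ t, 0 ≤ t → HasDerivWithinAt H (H' t) (Ici 0) t) (hH1 : ∀ t, H t ≤ 1) (hH0 : H 0 = 1)
    (hle : ∀ t, 0 ≤ t → -(α * (1 - H t)) ≤ H' t) {t : ℝ} (ht : 0 ≤ t) : H t = 1 := by
  have hanti : AntitoneOn (fun t => Real.exp (-α * t) * (1 - H t)) (Ici 0) :=
    antitoneOn_exp_mul (fun t _ => (hasDerivAt_id t).const_mul (-α))
      (fun t ht => (hH t ht).const_sub 1) fun t ht => by linarith [hle t ht]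
  have h : Real.exp (-α * t) * (1 - H t) ≤ 0 := by
    simpa [hH0] using hanti self_mem_Ici (mem_Ici.2 ht) ht
  exact le_antisymm (hH1 t) (by linarith [nonpos_of_mul_nonpos_right h (Real.exp_pos _)])

/-! ### Counting independent events -/

open scoped Classical in
lemma setOf_filter_mem_eq {ι α : Type*} [Fintype ι] {A : Set α} [DecidablePred (· ∈ A)]
    (S : Finset ι) :
    {x : ι → α | (Finset.univ.filter fun i => x i ∈ A) = S}
      = univ.pi fun i => if i ∈ S then A else Aᶜ := by
  ext x
  simp only [mem_ofPred_eq, Finset.ext_iff, Finset.mem_filter_univ, Set.mem_univ_pi]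
  refine forall_congr' fun i => ?_
  by_cases hi : i ∈ S <;> simp [hi]

section Counting

variable {ι α : Type*} [MeasurableSpace α]

lemma measurableSet_card_filter_le_lt {f : ι → α → ℝ} {g : α → ℝ} (s : Finset ι)
    (hf : ∀ i, Measurable (f i)) (hg : Measurable g) (c : ℕ) :
    MeasurableSet {a | (s.filter fun i => f i a ≤ g a).card < c} := by
  simp_rw [Finset.card_filter]
  refine measurableSet_lt (Finset.measurable_fun_sum _ fun i _ => ?_) measurable_const
  exact Measurable.ite (measurableSet_le (hf i) hg) measurable_const measurable_const

variable [Fintype ι] {A : Set α} [DecidablePred (· ∈ A)]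

variable (ν : Measure α) [IsProbabilityMeasure ν]

lemma pi_real_filter_mem_eq (hA : MeasurableSet A) (S : Finset ι) :
    (Measure.pi fun _ : ι => ν).real {x | (Finset.univ.filter fun i => x i ∈ A) = S}
      = (1 - ν.real Aᶜ) ^ S.card * ν.real Aᶜ ^ (Fintype.card ι - S.card) := by
  classical
  have hprob : ν.real A = 1 - ν.real Aᶜ := by
    rw [probReal_compl_eq_one_sub hA, sub_sub_cancel]
  rw [setOf_filter_mem_eq, measureReal_def, Measure.pi_pi, ENNReal.toReal_prod]
  simp_rw [apply_ite ν, apply_ite ENNReal.toReal, ← measureReal_def]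
  rw [Finset.prod_ite, Finset.prod_const, Finset.prod_const, hprob, Finset.filter_univ_mem,
    Finset.filter_not, Finset.filter_univ_mem, ← Finset.compl_eq_univ_sdiff, Finset.card_compl]

lemma pi_real_card_filter_mem_lt (hA : MeasurableSet A) (c : ℕ) :
    (Measure.pi fun _ : ι => ν).real {x | (Finset.univ.filter fun i => x i ∈ A).card < c}
      = binomTail (Fintype.card ι) c (ν.real Aᶜ) := by
  classical
  set x := ν.real Aᶜ
  set N := Fintype.card ι
  let F : (ι → α) → Finset ι := fun y => Finset.univ.filter fun i => y i ∈ A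
  have hF : ∀ S, MeasurableSet (F ⁻¹' {S}) := fun S => by
    have : F ⁻¹' {S} = univ.pi fun i => if i ∈ S then A else Aᶜ := setOf_filter_mem_eq S
    rw [this]
    exact MeasurableSet.univ_pi fun i => by split_ifs; exacts [hA, hA.compl]
  calc (Measure.pi fun _ : ι => ν).real {y | (F y).card < c}
      = ∑ S with S.card < c, (Measure.pi fun _ : ι => ν).real (F ⁻¹' {S}) := by
        rw [← measureReal_biUnion_finset
          (fun S _ T _ hST => (disjoint_singleton.2 hST).preimage F) fun S _ => hF S]
        congr 1; ext y; simp
    _ = ∑ S ∈ (Finset.univ : Finset ι).powerset,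
          if S.card < c then (1 - x) ^ S.card * x ^ (N - S.card) else 0 := by
        rw [Finset.powerset_univ, ← Finset.sum_filter]
        exact Finset.sum_congr rfl fun S _ => pi_real_filter_mem_eq ν hA S
    _ = ∑ a ∈ Finset.range (N + 1), if a < c then (N.choose a : ℝ) * (1 - x) ^ a * x ^ (N - a)
          else 0 := by
        rw [Finset.sum_powerset_apply_card
          (fun a => if a < c then (1 - x) ^ a * x ^ (N - a) else 0)]
        simp [N, mul_assoc]
    _ = binomTail N c x := by
        rw [← Finset.sum_filter, binomTail]
        refine Finset.sum_subset (fun a => by simp) fun a ha hn => ?_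
        have : N < a := by simp_all
        simp [Nat.choose_eq_zero_of_lt this]

lemma pi_real_card_filter_le_lt (ν : Measure ℝ) [IsProbabilityMeasure ν] (t : ℝ) (c : ℕ) :
    (Measure.pi fun _ : ι => ν).real {x | (Finset.univ.filter fun i => x i ≤ t).card < c}
      = binomTail (Fintype.card ι) c (ν.real (Ioi t)) := by
  have := pi_real_card_filter_mem_lt (ι := ι) ν (measurableSet_Iic (a := t)) c
  rwa [compl_Iic] at this

end Counting

lemma frontier_setOf_card_filter_le_lt_subset {ι : Type*} [Finite ι] (s : Finset ι) (t : ℝ)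
    (c : ℕ) :
    frontier {x : ι → ℝ | (s.filter fun i => x i ≤ t).card < c} ⊆ ⋃ i, {x | x i = t} := by
  refine compl_subset_compl.1 fun x hx => ?_
  simp only [mem_compl_iff, mem_iUnion, mem_ofPred_eq, not_exists] at hx
  have hi : ∀ i, ∀ᶠ y : ι → ℝ in 𝓝 x, (y i ≤ t ↔ x i ≤ t) := fun i => by
    have hc : Tendsto (fun y : ι → ℝ => y i) (𝓝 x) (𝓝 (x i)) := (continuous_apply i).tendsto x
    rcases lt_or_gt_of_ne (hx i) with h | h
    · filter_upwards [hc.eventually_le_const h] with y hy using iff_of_true hy h.le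
    · filter_upwards [hc.eventually_const_lt h] with y hy using iff_of_false hy.not_ge h.not_ge
  have hcard : ∀ᶠ y : ι → ℝ in 𝓝 x,
      ((s.filter fun i => y i ≤ t).card < c ↔ (s.filter fun i => x i ≤ t).card < c) := by
    filter_upwards [eventually_all.2 hi] with y hy
    rw [Finset.filter_congr fun i _ => hy i]
  rw [mem_compl_iff, frontier_eq_closure_inter_closure, mem_inter_iff, mem_closure_iff_frequently,
    mem_closure_iff_frequently]
  rintro ⟨h, h'⟩
  obtain ⟨y, hy, hxy⟩ := (h.and_eventually hcard).exists
  obtain ⟨z, hz, hxz⟩ := (h'.and_eventually hcard).exists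
  exact hz (hxz.2 (hxy.1 hy))

lemma pi_frontier_setOf_card_filter_le_lt {ι : Type*} [Fintype ι] (ν : Measure ℝ)
    [IsProbabilityMeasure ν] [NullSingletonClass ν] (s : Finset ι) (t : ℝ) (c : ℕ) :
    (Measure.pi fun _ : ι => ν)
      (frontier {x : ι → ℝ | (s.filter fun i => x i ≤ t).card < c}) = 0 :=
  measure_mono_null (frontier_setOf_card_filter_le_lt_subset s t c) <| measure_iUnion_null fun i =>
    (Measure.quasiMeasurePreserving_eval (fun _ : ι => ν) i).preimage_null (measure_singleton t)

/-! ### Exponential clocks -/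

lemma expMeasure_Ioi {r : ℝ} (hr : 0 < r) {x : ℝ} (hx : 0 ≤ x) :
    expMeasure r (Ioi x) = ENNReal.ofReal (Real.exp (-(r * x))) := by
  have := isProbabilityMeasure_expMeasure hr
  rw [← compl_Iic, ← ofReal_measureReal, probReal_compl_eq_one_sub measurableSet_Iic,
    ← cdf_eq_real, cdf_expMeasure_eq hr, if_pos hx, sub_sub_cancel]

lemma expMeasure_absolutelyContinuous (r : ℝ) : expMeasure r ≪ volume :=
  withDensity_absolutelyContinuous _ _

instance (r : ℝ) : NullSingletonClass (expMeasure r) :=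
  ⟨fun x => expMeasure_absolutelyContinuous r (measure_singleton x)⟩

lemma ae_pos_expMeasure {r : ℝ} (hr : 0 < r) : ∀ᵐ e ∂expMeasure r, 0 < e := by
  have := isProbabilityMeasure_expMeasure hr
  have h : expMeasure r (Ioi 0) = 1 := by simp [expMeasure_Ioi hr le_rfl]
  exact (prob_compl_eq_zero_iff measurableSet_Ioi).2 h

lemma expMeasure_eq_lintegral_pending {r : ℝ} (hr : 0 < r) {B : Set ℝ} (hB : MeasurableSet B) :
    expMeasure r B = ENNReal.ofReal r * ∫⁻ u in B, expMeasure r {e | 0 ≤ u ∧ u < e} := by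
  rw [← lintegral_const_mul' _ _ ENNReal.ofReal_ne_top, expMeasure, gammaMeasure,
    withDensity_apply _ hB]
  refine lintegral_congr fun u => ?_
  change exponentialPDF r u = _
  rcases lt_or_ge u 0 with hu | hu
  · simp [exponentialPDF_of_neg hu, hu.not_ge]
  · rw [exponentialPDF_of_nonneg hu, ENNReal.ofReal_mul hr.le]
    simp only [hu, true_and]
    rw [← expMeasure_Ioi hr hu]
    rfl

lemma expMeasure_add_mem {r : ℝ} (hr : 0 < r) {B : Set ℝ} (hB : MeasurableSet B) (w : ℝ) :
    expMeasure r {e | w + e ∈ B}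
      = ENNReal.ofReal r * ∫⁻ u in B, expMeasure r {e | w ≤ u ∧ u < w + e} := by
  have hw := measurePreserving_add_left volume w
  rw [← hw.setLIntegral_comp_preimage_emb (Homeomorph.addLeft w).measurableEmbedding _ B]
  refine (expMeasure_eq_lintegral_pending hr (hw.measurable hB)).trans ?_
  simp only [le_add_iff_nonneg_right, add_lt_add_iff_left]

lemma expMeasure_sub_mem {r : ℝ} (hr : 0 < r) {B : Set ℝ} (hB : MeasurableSet B) (x : ℝ) :
    expMeasure r {a | x - a ∈ B}
      = ENNReal.ofReal r * ∫⁻ u in B, expMeasure r {a | x - a ≤ u ∧ u < x} := by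
  have hx := volume.measurePreserving_sub_left x
  rw [← hx.setLIntegral_comp_preimage_emb (Homeomorph.subLeft x).measurableEmbedding _ B]
  refine (expMeasure_eq_lintegral_pending hr (hx.measurable hB)).trans ?_
  congr 1
  refine lintegral_congr_ae ?_
  filter_upwards [ae_restrict_of_ae (Measure.ae_ne volume 0)] with u hu
  rcases lt_or_gt_of_ne hu with h | h
  · simp [h.not_ge, h.not_gt]
  · have hset : {a | x - a ≤ x - u ∧ x - u < x} = Ici u := ext fun a =>
      ⟨fun ha => (sub_le_sub_iff_left x).1 ha.1, fun ha => ⟨sub_le_sub_left ha x, sub_lt_self x h⟩⟩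
    rw [hset, ← measure_congr (Ioi_ae_eq_Ici (μ := expMeasure r) (a := u))]
    simp only [h.le, true_and]
    rfl

lemma prod_apply_eq_lintegral_of_rate {Ω : Type*} [MeasurableSpace Ω] (P : Measure Ω) [SFinite P]
    (Q : Measure ℝ) [SFinite Q] {Y : Ω × ℝ → ℝ} (hY : Measurable Y) {c : ℝ≥0∞}
    {D : Set ((Ω × ℝ) × ℝ)} (hD : MeasurableSet D)
    (hrate : ∀ ω, ∀ B : Set ℝ, MeasurableSet B →
      Q {e | Y (ω, e) ∈ B} = c * ∫⁻ u in B, Q {e | ((ω, e), u) ∈ D})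
    {B : Set ℝ} (hB : MeasurableSet B) {S : Set (Ω × ℝ)} (hS : MeasurableSet S) :
    (P.prod Q) {p | Y p ∈ B ∧ (p.1, Y p) ∈ S}
      = c * ∫⁻ u in B, (P.prod Q) {p | (p, u) ∈ D ∧ (p.1, u) ∈ S} := by
  have hmeas : MeasurableSet {q : (Ω × ℝ) × ℝ | q ∈ D ∧ (q.1.1, q.2) ∈ S} :=
    hD.inter (hS.preimage (by fun_prop))
  have hsection : Measurable fun q : Ω × ℝ => Q {e | ((q.1, e), q.2) ∈ D ∧ q ∈ S} := by
    have hswap : Measurable fun z : (Ω × ℝ) × ℝ => ((z.1.1, z.2), z.1.2) := by fun_prop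
    exact measurable_measure_prodMk_left (hmeas.preimage hswap)
  calc (P.prod Q) {p | Y p ∈ B ∧ (p.1, Y p) ∈ S}
      = ∫⁻ ω, Q {e | Y (ω, e) ∈ B ∩ {u | (ω, u) ∈ S}} ∂P :=
        Measure.prod_apply ((hB.preimage hY).inter (hS.preimage (by fun_prop)))
    _ = ∫⁻ ω, (c * ∫⁻ u in B, Q {e | ((ω, e), u) ∈ D ∧ (ω, u) ∈ S}) ∂P := by
        refine lintegral_congr fun ω => ?_
        have hSω : MeasurableSet {u | (ω, u) ∈ S} := measurable_prodMk_left hS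
        rw [hrate ω _ (hB.inter hSω), inter_comm, ← Measure.restrict_restrict hSω,
          ← lintegral_indicator hSω]
        congr 2 with u
        by_cases hu : (ω, u) ∈ S <;> simp [hu]
    _ = c * ∫⁻ u in B, (∫⁻ ω, Q {e | ((ω, e), u) ∈ D ∧ (ω, u) ∈ S} ∂P) := by
        rw [lintegral_const_mul _ hsection.lintegral_prod_right', lintegral_lintegral_swap]
        exact hsection.aemeasurable
    _ = c * ∫⁻ u in B, (P.prod Q) {p | (p, u) ∈ D ∧ (p.1, u) ∈ S} := by
        congr 2 with u
        exact (Measure.prod_apply (hmeas.preimage measurable_prodMk_right)).symm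

section Crossing

variable {Ω : Type*} [MeasurableSpace Ω] (P : Measure Ω) [SFinite P] {r : ℝ} {X : Ω → ℝ} {B : Set ℝ}

lemma prod_expMeasure_add_mem (hr : 0 < r) (hX : Measurable X) (hB : MeasurableSet B)
    {S : Set (Ω × ℝ)} (hS : MeasurableSet S) :
    (P.prod (expMeasure r)) {p | X p.1 + p.2 ∈ B ∧ (p.1, X p.1 + p.2) ∈ S}
      = ENNReal.ofReal r * ∫⁻ u in B,
        (P.prod (expMeasure r)) {p | (X p.1 ≤ u ∧ u < X p.1 + p.2) ∧ (p.1, u) ∈ S} := by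
  have := isProbabilityMeasure_expMeasure hr
  have hle : MeasurableSet {q : (Ω × ℝ) × ℝ | X q.1.1 ≤ q.2} :=
    measurableSet_le (by fun_prop) (by fun_prop)
  have hlt : MeasurableSet {q : (Ω × ℝ) × ℝ | q.2 < X q.1.1 + q.1.2} :=
    measurableSet_lt (by fun_prop) (by fun_prop)
  exact prod_apply_eq_lintegral_of_rate P (expMeasure r) (by fun_prop) (hle.inter hlt)
    (fun ω _ hB => expMeasure_add_mem hr hB (X ω)) hB hS

lemma prod_expMeasure_sub_mem (hr : 0 < r) (hX : Measurable X) (hB : MeasurableSet B) :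
    (P.prod (expMeasure r)) {p | X p.1 - p.2 ∈ B}
      = ENNReal.ofReal r * ∫⁻ u in B,
        (P.prod (expMeasure r)) {p | X p.1 - p.2 ≤ u ∧ u < X p.1} := by
  have := isProbabilityMeasure_expMeasure hr
  have hle : MeasurableSet {q : (Ω × ℝ) × ℝ | X q.1.1 - q.1.2 ≤ q.2} :=
    measurableSet_le (by fun_prop) (by fun_prop)
  have hlt : MeasurableSet {q : (Ω × ℝ) × ℝ | q.2 < X q.1.1} :=
    measurableSet_lt (by fun_prop) (by fun_prop)
  have h := prod_apply_eq_lintegral_of_rate P (expMeasure r) (Y := fun p => X p.1 - p.2)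
    (by fun_prop) (hle.inter hlt) (fun ω _ hB => expMeasure_sub_mem hr hB (X ω)) hB
    MeasurableSet.univ
  simpa only [mem_univ, and_true, mem_inter_iff, mem_ofPred_eq] using h

end Crossing

/-! ### Order statistics -/

lemma setOf_le_card_filter_le_eq_Ici {N n : ℕ} (hn : 1 ≤ n) (hN : n ≤ N) (x : Fin N → ℝ) :
    {t : ℝ | n ≤ (Finset.univ.filter fun j => x j ≤ t).card} = Ici (orderStat n x) := by
  set A : Set ℝ := {t | n ≤ (Finset.univ.filter fun j => x j ≤ t).card} with hA
  have hclosed : IsClosed A := by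
    have hunion : A = ⋃ S ∈ {S : Finset (Fin N) | n ≤ S.card}, ⋂ j ∈ S, Ici (x j) := by
      ext t
      simp only [hA, mem_ofPred_eq, mem_iUnion, mem_iInter, mem_Ici, exists_prop]
      refine ⟨fun h => ⟨_, h, fun j hj => (Finset.mem_filter.1 hj).2⟩, fun ⟨S, hS, hxS⟩ => ?_⟩
      exact hS.trans (Finset.card_le_card fun j hj => Finset.mem_filter_univ j |>.2 (hxS j hj))
    rw [hunion]
    exact (toFinite _).isClosed_biUnion fun S _ => isClosed_biInter fun j _ => isClosed_Ici
  have hbdd : BddBelow A := by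
    obtain ⟨b, hb⟩ := (finite_range x).bddBelow
    refine ⟨b, fun t ht => ?_⟩
    obtain ⟨j, hj⟩ := Finset.card_pos.1 (Nat.lt_of_lt_of_le hn ht)
    exact (hb (mem_range_self j)).trans (Finset.mem_filter.1 hj).2
  have hne : A.Nonempty := by
    obtain ⟨b, hb⟩ := (finite_range x).bddAbove
    refine ⟨b, ?_⟩
    rw [hA, mem_ofPred_eq, Finset.filter_true_of_mem fun j _ => hb (mem_range_self j)]
    simpa using hN
  refine Subset.antisymm (fun t ht => csInf_le hbdd ht) fun t ht => ?_
  exact (hclosed.csInf_mem hne hbdd).trans (Finset.card_le_card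
    (Finset.monotone_filter_right _ fun j _ hj => hj.trans ht))

lemma lt_orderStat_iff {N n : ℕ} (hn : 1 ≤ n) (hN : n ≤ N) (x : Fin N → ℝ) (t : ℝ) :
    t < orderStat n x ↔ (Finset.univ.filter fun j => x j ≤ t).card < n := by
  rw [← not_le, ← mem_Ici, ← setOf_le_card_filter_le_eq_Ici hn hN, mem_ofPred_eq, not_le]

lemma preimage_orderStat_Ioi {N n : ℕ} (hn : 1 ≤ n) (hN : n ≤ N) (t : ℝ) :
    (orderStat n : (Fin N → ℝ) → ℝ) ⁻¹' Ioi t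
      = {x | (Finset.univ.filter fun j => x j ≤ t).card < n} :=
  ext fun x => lt_orderStat_iff hn hN x t

lemma measurable_orderStat {N n : ℕ} (hn : 1 ≤ n) (hN : n ≤ N) :
    Measurable (orderStat n : (Fin N → ℝ) → ℝ) := by
  refine measurable_of_Ioi fun t => ?_
  rw [preimage_orderStat_Ioi hn hN]
  exact measurableSet_card_filter_le_lt _ measurable_pi_apply measurable_const n

lemma pi_map_orderStat_real_Ioi {N n : ℕ} (hn : 1 ≤ n) (hN : n ≤ N) (ν : Measure ℝ)
    [IsProbabilityMeasure ν] (t : ℝ) :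
    ((Measure.pi fun _ : Fin N => ν).map (orderStat n)).real (Ioi t)
      = binomTail N n (ν.real (Ioi t)) := by
  rw [map_measureReal_apply (measurable_orderStat hn hN) measurableSet_Ioi,
    preimage_orderStat_Ioi hn hN, pi_real_card_filter_le_lt, Fintype.card_fin]

/-- The number of events other than `j` that have happened by time `u`, when event `i` happens at
time `x i`. -/
noncomputable def numOthersBefore {ι : Type*} [Fintype ι] [DecidableEq ι] (x : ι → ℝ) (j : ι)
    (u : ℝ) : ℕ :=
  ((Finset.univ.erase j).filter fun i => x i ≤ u).card

lemma card_filter_le_mono {ι : Type*} [Fintype ι] (x : ι → ℝ) :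
    Monotone fun u => (Finset.univ.filter fun i => x i ≤ u).card :=
  fun _ _ huv => Finset.card_le_card (Finset.monotone_filter_right _ fun _ _ h => h.trans huv)

section Rank

variable {ι : Type*} [Fintype ι] [DecidableEq ι] {x : ι → ℝ} {j : ι} {u : ℝ}

lemma numOthersBefore_eq_of_lt (h : u < x j) :
    numOthersBefore x j u = (Finset.univ.filter fun i => x i ≤ u).card := by
  rw [numOthersBefore, Finset.filter_erase, Finset.erase_eq_of_notMem (by simp [h])]

lemma numOthersBefore_add_one_of_le (h : x j ≤ u) :
    numOthersBefore x j u + 1 = (Finset.univ.filter fun i => x i ≤ u).card := by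
  rw [numOthersBefore, Finset.filter_erase, Finset.card_erase_add_one (by simp [h])]

lemma card_filter_le_le_numOthersBefore_iff :
    (Finset.univ.filter fun i => x i ≤ u).card ≤ numOthersBefore x j (x j) ↔ u < x j := by
  constructor
  · contrapose!
    intro h
    rw [Nat.lt_iff_add_one_le, numOthersBefore_add_one_of_le le_rfl]
    exact card_filter_le_mono x h
  · intro h
    rw [← numOthersBefore_eq_of_lt h]
    exact Finset.card_le_card (Finset.monotone_filter_right _ fun _ _ hi => hi.trans h.le)

lemma numOthersBefore_lt_numOthersBefore {i : ι} (h : x i < x j) :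
    numOthersBefore x i (x i) < numOthersBefore x j (x j) := by
  rw [Nat.lt_iff_add_one_le, numOthersBefore_add_one_of_le le_rfl]
  exact card_filter_le_le_numOthersBefore_iff.2 h

lemma injective_numOthersBefore (hx : Function.Injective x) :
    Function.Injective fun j => numOthersBefore x j (x j) := fun i j hij => by
  by_contra hne
  rcases lt_or_gt_of_ne (hx.ne hne) with h | h
  · exact (numOthersBefore_lt_numOthersBefore h).ne hij
  · exact (numOthersBefore_lt_numOthersBefore h).ne' hij

lemma image_numOthersBefore (hx : Function.Injective x) :
    Finset.univ.image (fun j => numOthersBefore x j (x j)) = Finset.range (Fintype.card ι) := by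
  refine Finset.eq_of_subset_of_card_le (Finset.image_subset_iff.2 fun j _ => ?_) ?_
  · rw [Finset.mem_range, Nat.lt_iff_add_one_le, numOthersBefore_add_one_of_le le_rfl]
    exact Finset.card_le_univ _
  · rw [Finset.card_image_of_injective _ (injective_numOthersBefore hx), Finset.card_range,
      Finset.card_univ]

lemma card_filter_lt_and_numOthersBefore_lt (hx : Function.Injective x) {n : ℕ}
    (hn : n ≤ Fintype.card ι) (s : ℝ) :
    (Finset.univ.filter fun j => s < x j ∧ numOthersBefore x j (x j) < n).card
      = ((Finset.range n).filter fun c =>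
          (Finset.univ.filter fun j => x j ≤ s).card < c + 1).card := by
  refine Finset.card_bij (fun j _ => numOthersBefore x j (x j)) (fun j hj => ?_)
    (fun i _ j _ h => injective_numOthersBefore hx h) fun c hc => ?_
  · simpa [Nat.lt_succ_iff, card_filter_le_le_numOthersBefore_iff, and_comm] using hj
  · rw [Finset.mem_filter, Finset.mem_range] at hc
    have hrank : c ∈ Finset.univ.image fun j => numOthersBefore x j (x j) := by
      rw [image_numOthersBefore hx, Finset.mem_range]
      exact hc.1.trans_le hn
    obtain ⟨j, -, rfl⟩ := Finset.mem_image.1 hrank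
    refine ⟨j, ?_, rfl⟩
    simpa [Nat.lt_succ_iff, card_filter_le_le_numOthersBefore_iff, and_comm] using hc

end Rank

/-! ### Arriving batches -/

lemma measurePreserving_update_pi {ι : Type*} [Fintype ι] [DecidableEq ι] {α : ι → Type*}
    [∀ i, MeasurableSpace (α i)] (μ : ∀ i, Measure (α i)) [∀ i, SigmaFinite (μ i)] (j : ι)
    [IsProbabilityMeasure (μ j)] :
    MeasurePreserving (fun p : (∀ i, α i) × α j => Function.update p.1 j p.2)
      ((Measure.pi μ).prod (μ j)) (Measure.pi μ) := by
  have hmeas : Measurable fun p : (∀ i, α i) × α j => Function.update p.1 j p.2 :=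
    measurable_update'
  refine ⟨hmeas, (Measure.pi_eq fun s hs => ?_).symm⟩
  have hpre : (fun p : (∀ i, α i) × α j => Function.update p.1 j p.2) ⁻¹' univ.pi s
      = univ.pi (Function.update s j univ) ×ˢ s j := by
    ext p
    simp only [mem_preimage, Set.mem_univ_pi, mem_prod]
    rw [Function.forall_update_iff p.1 (fun i y => y ∈ s i),
      Function.forall_update_iff s (fun i t => p.1 i ∈ t)]
    simp [and_comm]
  rw [Measure.map_apply hmeas (MeasurableSet.univ_pi hs), hpre, Measure.prod_prod, Measure.pi_pi,
    ← Finset.prod_erase_mul _ _ (Finset.mem_univ j),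
    ← Finset.prod_erase_mul _ _ (Finset.mem_univ j),
    Function.update_self, measure_univ, mul_one]
  congr 1
  exact Finset.prod_congr rfl fun i hi => by rw [Function.update_of_ne (Finset.ne_of_mem_erase hi)]

/-- The workloads found by a batch, the queues it is sent to, and its service requirements. -/
abbrev Arrival (k N : ℕ) : Type := (Fin k → ℝ) × (Fin N → Fin k) × (Fin N → ℝ)

/-- The completion times of the jobs of a batch if none were ever removed. -/
def virtualTimes {k N : ℕ} (p : Arrival k N) : Fin N → ℝ := fun j => p.1 (p.2.1 j) + p.2.2 j

/-- The arrival `p` with the service requirement of job `j` replaced by `y`. -/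
def resample {k N : ℕ} (j : Fin N) (p : Arrival k N) (y : ℝ) : Arrival k N :=
  (p.1, p.2.1, Function.update p.2.2 j y)

section Arrival

variable {k N n : ℕ}

lemma workload_resample (i j : Fin N) (p : Arrival k N) (y : ℝ) :
    (resample j p y).1 ((resample j p y).2.1 i) = p.1 (p.2.1 i) :=
  rfl

lemma virtualTimes_resample_self (j : Fin N) (p : Arrival k N) (y : ℝ) :
    virtualTimes (resample j p y) j = p.1 (p.2.1 j) + y := by
  simp [virtualTimes, resample]

lemma virtualTimes_resample_of_ne {i j : Fin N} (h : i ≠ j) (p : Arrival k N) (y : ℝ) :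
    virtualTimes (resample j p y) i = virtualTimes p i := by
  simp [virtualTimes, resample, h]

lemma numOthersBefore_resample (j : Fin N) (p : Arrival k N) (y u : ℝ) :
    numOthersBefore (virtualTimes (resample j p y)) j u = numOthersBefore (virtualTimes p) j u := by
  refine congrArg Finset.card (Finset.filter_congr fun i hi => ?_)
  rw [virtualTimes_resample_of_ne (Finset.ne_of_mem_erase hi)]

lemma measurable_workload_apply (j : Fin N) : Measurable fun p : Arrival k N => p.1 (p.2.1 j) := by
  have heq : (fun p : Arrival k N => p.1 (p.2.1 j))
      = fun p => ∑ q, if p.2.1 j = q then p.1 q else 0 := by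
    ext p; simp
  rw [heq]
  refine Finset.measurable_fun_sum _ fun q _ => Measurable.ite ?_ (by fun_prop) measurable_const
  exact (by fun_prop : Measurable fun p : Arrival k N => p.2.1 j) (measurableSet_singleton q)

lemma measurable_virtualTimes : Measurable (virtualTimes : Arrival k N → Fin N → ℝ) :=
  measurable_pi_lambda _ fun j => (measurable_workload_apply j).add (by fun_prop)

lemma measurable_virtualTimes_apply (j : Fin N) :
    Measurable fun p : Arrival k N => virtualTimes p j :=
  (measurable_pi_apply j).comp measurable_virtualTimes

lemma measurableSet_numOthersBefore_lt (j : Fin N) (c : ℕ) :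
    MeasurableSet {q : Arrival k N × ℝ | numOthersBefore (virtualTimes q.1) j q.2 < c} :=
  measurableSet_card_filter_le_lt (f := fun i (q : Arrival k N × ℝ) => virtualTimes q.1 i)
    _ (fun i => (measurable_virtualTimes_apply i).comp measurable_fst) measurable_snd c

lemma measurable_completionTime (hn : 1 ≤ n) (hN : n ≤ N) :
    Measurable fun p : Arrival k N => completionTime n p.1 p.2.1 p.2.2 :=
  (measurable_orderStat hn hN).comp measurable_virtualTimes

lemma measurable_workloadAfter (hn : 1 ≤ n) (hN : n ≤ N) (q : Fin k) :
    Measurable fun p : Arrival k N => workloadAfter n p.1 p.2.1 p.2.2 q := by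
  unfold workloadAfter receivedService
  simp only [Finset.sum_filter]
  refine Measurable.add (by fun_prop) (Finset.measurable_fun_sum _ fun j _ =>
    Measurable.ite ?_ ?_ measurable_const)
  · exact (by fun_prop : Measurable fun p : Arrival k N => p.2.1 j) (measurableSet_singleton q)
  · refine measurable_const.max (Measurable.min (by fun_prop) ?_)
    exact (measurable_completionTime hn hN).sub (measurable_workload_apply j)

lemma measurable_nextWorkload (hn : 1 ≤ n) (hN : n ≤ N) :
    Measurable fun p : Arrival k N × ℝ => nextWorkload n p.1.1 p.1.2.1 p.1.2.2 p.2 :=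
  measurable_pi_lambda _ fun q => measurable_const.max
    (((measurable_workloadAfter hn hN q).comp measurable_fst).sub measurable_snd)

lemma isProbabilityMeasure_uniformOn_injective (h : N ≤ k) :
    IsProbabilityMeasure (uniformOn {σ : Fin N → Fin k | Function.Injective σ}) :=
  isProbabilityMeasure_uniformOn (toFinite _) ⟨Fin.castLE h, Fin.castLE_injective h⟩

instance (π : Measure (Fin k → ℝ)) [SFinite π] : SFinite (arrivalLaw N π) := by
  have := isProbabilityMeasure_expMeasure zero_lt_one
  unfold arrivalLaw
  infer_instance

lemma isProbabilityMeasure_arrivalLaw (h : N ≤ k) (π : Measure (Fin k → ℝ))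
    [IsProbabilityMeasure π] : IsProbabilityMeasure (arrivalLaw N π) := by
  have := isProbabilityMeasure_uniformOn_injective h
  have := isProbabilityMeasure_expMeasure zero_lt_one
  unfold arrivalLaw
  infer_instance

lemma measurePreserving_fst_arrivalLaw (h : N ≤ k) (π : Measure (Fin k → ℝ)) :
    MeasurePreserving Prod.fst (arrivalLaw N π) π := by
  have := isProbabilityMeasure_uniformOn_injective h
  have := isProbabilityMeasure_expMeasure zero_lt_one
  exact measurePreserving_fst

lemma ae_uniformOn_injective :
    ∀ᵐ σ ∂(uniformOn {σ : Fin N → Fin k | Function.Injective σ}), Function.Injective σ :=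
  ae_cond_mem (toFinite _).measurableSet

lemma ae_arrivalLaw_injective (π : Measure (Fin k → ℝ)) :
    ∀ᵐ p ∂(arrivalLaw N π), Function.Injective p.2.1 :=
  Measure.quasiMeasurePreserving_snd.ae
    (Measure.quasiMeasurePreserving_fst.ae ae_uniformOn_injective)

variable (π : Measure (Fin k → ℝ)) [IsProbabilityMeasure π]

lemma measurePreserving_resample (j : Fin N) :
    MeasurePreserving (fun q : Arrival k N × ℝ => resample j q.1 q.2)
      ((arrivalLaw N π).prod (expMeasure 1)) (arrivalLaw N π) := by
  have := isProbabilityMeasure_expMeasure zero_lt_one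
  have hassoc := measurePreserving_prodAssoc π
    ((uniformOn {σ : Fin N → Fin k | Function.Injective σ}).prod
      (Measure.pi fun _ : Fin N => expMeasure 1)) (expMeasure 1)
  have hassoc' := measurePreserving_prodAssoc
    (uniformOn {σ : Fin N → Fin k | Function.Injective σ})
    (Measure.pi fun _ : Fin N => expMeasure 1) (expMeasure 1)
  have hupdate := measurePreserving_update_pi (fun _ : Fin N => expMeasure 1) j
  exact ((MeasurePreserving.id π).prod
    (((MeasurePreserving.id _).prod hupdate).comp hassoc')).comp hassoc

lemma arrivalLaw_virtualTimes_eq {i j : Fin N} (hij : i ≠ j) :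
    arrivalLaw N π {p | virtualTimes p i = virtualTimes p j} = 0 := by
  have hmeas : MeasurableSet {p : Arrival k N | virtualTimes p i = virtualTimes p j} :=
    measurableSet_eq_fun (measurable_virtualTimes_apply i) (measurable_virtualTimes_apply j)
  have hres := measurePreserving_resample π j
  have := isProbabilityMeasure_expMeasure zero_lt_one
  rw [← hres.measure_preimage hmeas.nullMeasurableSet,
    Measure.measure_prod_null (hmeas.preimage hres.measurable)]
  refine Eventually.of_forall fun p => ?_
  refine measure_mono_null (fun y hy => ?_)
    (measure_singleton (μ := expMeasure 1) (virtualTimes p i - p.1 (p.2.1 j)))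
  have hy : virtualTimes p i = p.1 (p.2.1 j) + y := by
    simpa [virtualTimes_resample_self, virtualTimes_resample_of_ne hij] using hy
  rw [mem_singleton_iff, hy, add_sub_cancel_left]

lemma ae_injective_virtualTimes : ∀ᵐ p ∂(arrivalLaw N π), Function.Injective (virtualTimes p) := by
  have h : ∀ i j, ∀ᵐ p ∂(arrivalLaw N π), virtualTimes p i = virtualTimes p j → i = j := by
    intro i j
    by_cases hij : i = j
    · simp [hij]
    · simpa [ae_iff, hij] using arrivalLaw_virtualTimes_eq π hij
  filter_upwards [ae_all_iff.2 fun i => ae_all_iff.2 (h i)] with p hp i j using hp i j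

end Arrival

/-! ### Level crossings in the stationary system -/

lemma measure_le_and_lt_add_measure_lt {Ω : Type*} [MeasurableSpace Ω] {μ : Measure Ω}
    {f g : Ω → ℝ} (hf : Measurable f) (hfg : ∀ᵐ ω ∂μ, f ω ≤ g ω) (u : ℝ) :
    μ {ω | f ω ≤ u ∧ u < g ω} + μ {ω | u < f ω} = μ {ω | u < g ω} := by
  have hinter : μ {ω | u < f ω} = μ ({ω | u < g ω} ∩ {ω | u < f ω}) := by
    refine measure_congr ?_
    filter_upwards [hfg] with ω h
    exact propext ⟨fun hu => ⟨hu.trans_le h, hu⟩, fun hu => hu.2⟩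
  have hdiff : {ω | f ω ≤ u ∧ u < g ω} = {ω | u < g ω} \ {ω | u < f ω} := by
    ext ω
    simp [and_comm]
  rw [hinter, hdiff, measure_sdiff_add_inter _ (measurableSet_lt measurable_const hf)]

lemma sum_measure_eq_lintegral_card {α ι : Type*} [MeasurableSpace α] {μ : Measure α}
    (s : Finset ι) {S : ι → Set α} [∀ a, DecidablePred (a ∈ S ·)]
    (hS : ∀ i, MeasurableSet (S i)) :
    ∑ i ∈ s, μ (S i) = ∫⁻ a, ((s.filter (a ∈ S ·)).card : ℝ≥0∞) ∂μ := by
  simp_rw [← lintegral_indicator_one (hS _)]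
  rw [← lintegral_finsetSum _ fun i _ => measurable_one.indicator (hS i)]
  refine lintegral_congr fun a => ?_
  rw [Finset.card_filter, Nat.cast_sum]
  exact Finset.sum_congr rfl fun i _ => by simp [indicator_apply]

lemma sum_measure_congr_card {α ι κ : Type*} [MeasurableSpace α] {μ : Measure α}
    {s : Finset ι} {t : Finset κ} {S : ι → Set α} {T : κ → Set α} [∀ a, DecidablePred (a ∈ S ·)]
    [∀ a, DecidablePred (a ∈ T ·)] (hS : ∀ i, MeasurableSet (S i)) (hT : ∀ j, MeasurableSet (T j))
    (h : ∀ᵐ a ∂μ, (s.filter (a ∈ S ·)).card = (t.filter (a ∈ T ·)).card) :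
    ∑ i ∈ s, μ (S i) = ∑ j ∈ t, μ (T j) := by
  rw [sum_measure_eq_lintegral_card s hS, sum_measure_eq_lintegral_card t hT]
  exact lintegral_congr_ae (h.mono fun a ha => congrArg _ ha)

lemma le_workloadAfter {k N n : ℕ} (p : Arrival k N) (q : Fin k) :
    p.1 q ≤ workloadAfter n p.1 p.2.1 p.2.2 q :=
  le_add_of_nonneg_right (Finset.sum_nonneg fun _ _ => le_max_left _ _)

lemma workloadAfter_of_forall_ne {k N n : ℕ} (p : Arrival k N) {q : Fin k} (hq : ∀ j, p.2.1 j ≠ q) :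
    workloadAfter n p.1 p.2.1 p.2.2 q = p.1 q := by
  rw [workloadAfter, Finset.filter_false_of_mem fun j _ => hq j, Finset.sum_empty, add_zero]

lemma workloadAfter_apply {k N n : ℕ} {p : Arrival k N} (hp : Function.Injective p.2.1)
    (j : Fin N) : workloadAfter n p.1 p.2.1 p.2.2 (p.2.1 j)
      = p.1 (p.2.1 j) + receivedService n p.1 p.2.1 p.2.2 j := by
  have hfilter : (Finset.univ.filter fun i => p.2.1 i = p.2.1 j) = {j} := by
    ext i; simp [hp.eq_iff]
  rw [workloadAfter, hfilter, Finset.sum_singleton]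

lemma le_and_lt_workloadAfter_iff {k N n : ℕ} (hn : 1 ≤ n) (hN : n ≤ N) {p : Arrival k N}
    (hp : Function.Injective p.2.1) (j : Fin N) (u : ℝ) :
    (p.1 (p.2.1 j) ≤ u ∧ u < workloadAfter n p.1 p.2.1 p.2.2 (p.2.1 j))
      ↔ ((p.1 (p.2.1 j) ≤ u ∧ u < virtualTimes p j)
        ∧ numOthersBefore (virtualTimes p) j u < n) := by
  have hlt : numOthersBefore (virtualTimes p) j u < n ∧ u < virtualTimes p j
      ↔ u < completionTime n p.1 p.2.1 p.2.2 ∧ u < virtualTimes p j := by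
    refine and_congr_left fun hu => ?_
    rw [numOthersBefore_eq_of_lt hu, ← lt_orderStat_iff hn hN]
    rfl
  have hmax : p.1 (p.2.1 j) ≤ u → (u < workloadAfter n p.1 p.2.1 p.2.2 (p.2.1 j)
      ↔ u < completionTime n p.1 p.2.1 p.2.2 ∧ u < virtualTimes p j) := fun hw => by
    rw [workloadAfter_apply hp, receivedService, ← sub_lt_iff_lt_add', lt_max_iff, lt_min_iff,
      or_iff_right (by linarith), sub_lt_sub_iff_right, sub_lt_iff_lt_add', and_comm]
    rfl
  rw [and_assoc, and_comm (a := u < virtualTimes p j), hlt]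
  exact and_congr_right hmax

lemma card_le_and_lt_workloadAfter {k N n : ℕ} (hn : 1 ≤ n) (hN : n ≤ N) {p : Arrival k N}
    (hp : Function.Injective p.2.1) (u : ℝ) :
    (Finset.univ.filter fun q => p.1 q ≤ u ∧ u < workloadAfter n p.1 p.2.1 p.2.2 q).card
      = (Finset.univ.filter fun j => (p.1 (p.2.1 j) ≤ u ∧ u < virtualTimes p j)
        ∧ numOthersBefore (virtualTimes p) j u < n).card := by
  symm
  refine Finset.card_bij (fun j _ => p.2.1 j) (fun j hj => ?_) (fun i _ j _ h => hp h)
    fun q hq => ?_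
  · simpa [le_and_lt_workloadAfter_iff hn hN hp j u] using hj
  · rw [Finset.mem_filter_univ] at hq
    obtain ⟨j, rfl⟩ : ∃ j, p.2.1 j = q := by
      by_contra! hne
      rw [workloadAfter_of_forall_ne p hne] at hq
      exact hq.1.not_gt hq.2
    exact ⟨j, by simpa [le_and_lt_workloadAfter_iff hn hN hp j u] using hq, rfl⟩

section Finite

variable {k N n : ℕ}

lemma measurableSet_pending (j : Fin N) (c : ℕ) :
    MeasurableSet {z : Arrival k N × ℝ | (z.1.1 (z.1.2.1 j) ≤ z.2 ∧ z.2 < virtualTimes z.1 j)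
      ∧ numOthersBefore (virtualTimes z.1) j z.2 < c} :=
  ((measurableSet_le ((measurable_workload_apply j).comp measurable_fst) measurable_snd).inter
    (measurableSet_lt measurable_snd ((measurable_virtualTimes_apply j).comp measurable_fst))).inter
    (measurableSet_numOthersBefore_lt j c)

lemma measurableSet_le_and_lt_workloadAfter (hn : 1 ≤ n) (hN : n ≤ N) (q : Fin k) :
    MeasurableSet {z : Arrival k N × ℝ |
      z.1.1 q ≤ z.2 ∧ z.2 < workloadAfter n z.1.1 z.1.2.1 z.1.2.2 q} :=
  (measurableSet_le ((measurable_pi_apply q).comp (measurable_fst.comp measurable_fst))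
    measurable_snd).inter
    (measurableSet_lt measurable_snd ((measurable_workloadAfter hn hN q).comp measurable_fst))

lemma measurableSet_virtualTimes_mem_and_lt (j : Fin N) (c : ℕ) {B : Set ℝ}
    (hB : MeasurableSet B) :
    MeasurableSet {p : Arrival k N | virtualTimes p j ∈ B
      ∧ numOthersBefore (virtualTimes p) j (virtualTimes p j) < c} :=
  (hB.preimage (measurable_virtualTimes_apply j)).inter
    ((measurableSet_numOthersBefore_lt j c).preimage
      (measurable_id.prodMk (measurable_virtualTimes_apply j)))

lemma sum_arrivalLaw_workloadAfter (π : Measure (Fin k → ℝ)) (hn : 1 ≤ n) (hN : n ≤ N) (u : ℝ) :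
    ∑ q, arrivalLaw N π {p | p.1 q ≤ u ∧ u < workloadAfter n p.1 p.2.1 p.2.2 q}
      = ∑ j, arrivalLaw N π {p | (p.1 (p.2.1 j) ≤ u ∧ u < virtualTimes p j)
        ∧ numOthersBefore (virtualTimes p) j u < n} := by
  refine sum_measure_congr_card
    (fun q => (measurableSet_le_and_lt_workloadAfter hn hN q).preimage measurable_prodMk_right)
    (fun j => (measurableSet_pending j n).preimage measurable_prodMk_right) ?_
  filter_upwards [ae_arrivalLaw_injective π] with p hp
  exact card_le_and_lt_workloadAfter hn hN hp u

variable (π : Measure (Fin k → ℝ)) [IsProbabilityMeasure π]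

lemma arrivalLaw_virtualTimes_mem_and_lt (j : Fin N) (c : ℕ) {B : Set ℝ} (hB : MeasurableSet B) :
    arrivalLaw N π {p | virtualTimes p j ∈ B
        ∧ numOthersBefore (virtualTimes p) j (virtualTimes p j) < c}
      = ∫⁻ u in B, arrivalLaw N π {p | (p.1 (p.2.1 j) ≤ u ∧ u < virtualTimes p j)
        ∧ numOthersBefore (virtualTimes p) j u < c} := by
  have hres := measurePreserving_resample π j
  have hslice : ∀ u, MeasurableSet {p : Arrival k N |
      (p.1 (p.2.1 j) ≤ u ∧ u < virtualTimes p j) ∧ numOthersBefore (virtualTimes p) j u < c} :=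
    fun u => (measurableSet_pending j c).preimage measurable_prodMk_right
  rw [← hres.measure_preimage (measurableSet_virtualTimes_mem_and_lt j c hB).nullMeasurableSet]
  simp_rw [← fun u => hres.measure_preimage (hslice u).nullMeasurableSet]
  simpa only [preimage_ofPred_eq, mem_ofPred_eq, ENNReal.ofReal_one, one_mul,
    workload_resample, virtualTimes_resample_self, numOthersBefore_resample] using
    prod_expMeasure_add_mem (arrivalLaw N π) one_pos (measurable_workload_apply j)
    hB (measurableSet_numOthersBefore_lt j c)

lemma sum_arrivalLaw_lt_and_numOthersBefore_lt (hN : n ≤ N) (s : ℝ) :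
    ∑ j, arrivalLaw N π {p | s < virtualTimes p j
        ∧ numOthersBefore (virtualTimes p) j (virtualTimes p j) < n}
      = ∑ c ∈ Finset.range n, arrivalLaw N π
          {p | (Finset.univ.filter fun j => virtualTimes p j ≤ s).card < c + 1} := by
  refine sum_measure_congr_card
    (fun j => measurableSet_virtualTimes_mem_and_lt j n measurableSet_Ioi) (fun c => ?_) ?_
  · exact measurableSet_card_filter_le_lt _ measurable_virtualTimes_apply measurable_const _
  · filter_upwards [ae_injective_virtualTimes π] with p hp
    exact card_filter_lt_and_numOthersBefore_lt hp (by simpa using hN) s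

end Finite

lemma rate_pos {k n m : ℕ} {lam : ℝ} (hn : 1 ≤ n) (hlam : 0 < lam) (hk : n + m ≤ k) :
    0 < lam * k / n := by
  have : 0 < k := by lia
  positivity

namespace IsStationary

variable {k n m : ℕ} {lam : ℝ} {π : Measure (Fin k → ℝ)}

lemma measure_lt_eq (hπ : IsStationary n m lam π) (hn : 1 ≤ n) (q : Fin k) {u : ℝ} (hu : 0 ≤ u) :
    π {w | u < w q} = ((arrivalLaw (n + m) π).prod (expMeasure (lam * k / n)))
      {p | u < workloadAfter n p.1.1 p.1.2.1 p.1.2.2 q - p.2} := by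
  have hmeas := measurable_nextWorkload (k := k) hn (Nat.le_add_right n m)
  conv_lhs => rw [← hπ.invariant, stepLaw, Measure.map_apply hmeas
    (measurableSet_lt measurable_const (measurable_pi_apply q))]
  congr 1
  ext p
  simp [nextWorkload, hu.not_gt]

lemma measure_downcrossing_eq_upcrossing (hπ : IsStationary n m lam π) (hn : 1 ≤ n)
    (hlam : 0 < lam) (hk : n + m ≤ k) (q : Fin k) {u : ℝ} (hu : 0 ≤ u) :
    ((arrivalLaw (n + m) π).prod (expMeasure (lam * k / n)))
        {p | workloadAfter n p.1.1 p.1.2.1 p.1.2.2 q - p.2 ≤ u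
          ∧ u < workloadAfter n p.1.1 p.1.2.1 p.1.2.2 q}
      = arrivalLaw (n + m) π {p | p.1 q ≤ u ∧ u < workloadAfter n p.1 p.2.1 p.2.2 q} := by
  have := hπ.isProbabilityMeasure
  have := isProbabilityMeasure_expMeasure (rate_pos hn hlam hk)
  have hafter := measurable_workloadAfter (k := k) hn (Nat.le_add_right n m) q
  -- By stationarity, `{u < w q}` completes both events to `{u < workloadAfter q}`.
  have hdown := measure_le_and_lt_add_measure_lt
    (μ := (arrivalLaw (n + m) π).prod (expMeasure (lam * k / n)))
    (hafter.comp measurable_fst |>.sub measurable_snd)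
    (Measure.quasiMeasurePreserving_snd.ae (ae_pos_expMeasure (rate_pos hn hlam hk)) |>.mono
      fun p hp => sub_le_self _ hp.le) u
  have hup := measure_le_and_lt_add_measure_lt (μ := arrivalLaw (n + m) π)
    ((measurable_pi_apply q).comp measurable_fst)
    (Eventually.of_forall fun p => le_workloadAfter (n := n) p q) u
  have hfound : arrivalLaw (n + m) π {p | u < p.1 q} = π {w | u < w q} :=
    (measurePreserving_fst_arrivalLaw hk π).measure_preimage
      (measurableSet_lt measurable_const (measurable_pi_apply q)).nullMeasurableSet
  have hleft : ((arrivalLaw (n + m) π).prod (expMeasure (lam * k / n)))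
      {p | u < workloadAfter n p.1.1 p.1.2.1 p.1.2.2 q}
      = arrivalLaw (n + m) π {p | u < workloadAfter n p.1 p.2.1 p.2.2 q} :=
    measurePreserving_fst.measure_preimage
      (measurableSet_lt measurable_const hafter).nullMeasurableSet
  refine (ENNReal.add_left_inj (measure_ne_top π {w | u < w q})).1 ?_
  conv_lhs => rw [hπ.measure_lt_eq hn q hu]
  conv_rhs => rw [← hfound]
  exact (hdown.trans hleft).trans hup.symm

lemma measure_workload_lt (hπ : IsStationary n m lam π) (hn : 1 ≤ n) (hlam : 0 < lam)
    (hk : n + m ≤ k) (q : Fin k) {s : ℝ} (hs : 0 ≤ s) :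
    π {w | s < w q} = ENNReal.ofReal (lam * k / n) * ∫⁻ u in Ioi s, arrivalLaw (n + m) π
      {p | p.1 q ≤ u ∧ u < workloadAfter n p.1 p.2.1 p.2.2 q} := by
  have := hπ.isProbabilityMeasure
  rw [hπ.measure_lt_eq hn q hs]
  refine (prod_expMeasure_sub_mem _ (rate_pos hn hlam hk)
    (measurable_workloadAfter hn (Nat.le_add_right n m) q) measurableSet_Ioi).trans ?_
  congr 1
  exact setLIntegral_congr_fun measurableSet_Ioi fun u hu =>
    hπ.measure_downcrossing_eq_upcrossing hn hlam hk q (hs.trans (le_of_lt hu))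

lemma sum_measure_workload_lt (hπ : IsStationary n m lam π) (hn : 1 ≤ n) (hlam : 0 < lam)
    (hk : n + m ≤ k) {s : ℝ} (hs : 0 ≤ s) :
    ∑ q, π {w | s < w q} = ENNReal.ofReal (lam * k / n) * ∑ c ∈ Finset.range n,
      arrivalLaw (n + m) π
        {p | (Finset.univ.filter fun j => virtualTimes p j ≤ s).card < c + 1} := by
  have := hπ.isProbabilityMeasure
  have hN := Nat.le_add_right n m
  calc ∑ q, π {w | s < w q}
      = ENNReal.ofReal (lam * k / n) * ∑ q, ∫⁻ u in Ioi s, arrivalLaw (n + m) π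
          {p | p.1 q ≤ u ∧ u < workloadAfter n p.1 p.2.1 p.2.2 q} := by
        rw [Finset.mul_sum]
        exact Finset.sum_congr rfl fun q _ => hπ.measure_workload_lt hn hlam hk q hs
    _ = ENNReal.ofReal (lam * k / n) * ∑ j, ∫⁻ u in Ioi s, arrivalLaw (n + m) π
          {p | (p.1 (p.2.1 j) ≤ u ∧ u < virtualTimes p j)
            ∧ numOthersBefore (virtualTimes p) j u < n} := by
        rw [← lintegral_finsetSum, ← lintegral_finsetSum]
        · simp_rw [sum_arrivalLaw_workloadAfter π hn hN]
        · exact fun j _ => measurable_measure_prodMk_right (measurableSet_pending j n)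
        · exact fun q _ => measurable_measure_prodMk_right
            (measurableSet_le_and_lt_workloadAfter hn hN q)
    _ = _ := by
        simp_rw [← arrivalLaw_virtualTimes_mem_and_lt π _ n measurableSet_Ioi, mem_Ioi,
          sum_arrivalLaw_lt_and_numOthersBefore_lt π hN]

end IsStationary

/-! ### A typical queue -/

section TypicalQueue

variable {k N : ℕ}

lemma uniformOn_injective_apply_eq (h : N ≤ k) (j : Fin N) (q : Fin k) :
    uniformOn {σ : Fin N → Fin k | Function.Injective σ} {σ | σ j = q} = (k : ℝ≥0∞)⁻¹ := by
  have := isProbabilityMeasure_uniformOn_injective h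
  set U := uniformOn {σ : Fin N → Fin k | Function.Injective σ} with hU
  have hsymm : ∀ q', U {σ | σ j = q'} = U {σ | σ j = q} := by
    intro q'
    have himage : (Equiv.swap q q' ∘ ·) ''
        ({σ : Fin N → Fin k | Function.Injective σ} ∩ {σ | σ j = q})
        = {σ | Function.Injective σ} ∩ {σ | σ j = q'} := by
      ext σ
      constructor
      · rintro ⟨τ, ⟨hτ, rfl⟩, rfl⟩
        exact ⟨(Equiv.injective _).comp hτ, Equiv.swap_apply_left _ _⟩
      · rintro ⟨hσ, rfl⟩
        exact ⟨Equiv.swap q (σ j) ∘ σ, ⟨(Equiv.injective _).comp hσ, Equiv.swap_apply_right _ _⟩,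
          by ext; simp⟩
    simp only [hU, uniformOn, cond_apply (toFinite _).measurableSet]
    rw [← himage, Measure.count_injective_image (Equiv.injective _).comp_left]
  have hsum : ∑ q', U {σ | σ j = q'} = 1 := by
    have h := sum_measure_preimage_singleton (μ := U) Finset.univ
      fun q' _ => (toFinite ((fun σ : Fin N → Fin k => σ j) ⁻¹' {q'})).measurableSet
    simpa [preimage] using h
  rw [Finset.sum_congr rfl fun q' _ => hsymm q', Finset.sum_const, Finset.card_univ,
    Fintype.card_fin, nsmul_eq_mul] at hsum
  exact ENNReal.eq_inv_of_mul_eq_one_left (mul_comm (k : ℝ≥0∞) _ ▸ hsum)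

lemma arrivalLaw_workload_lt_eq_sum (h : N ≤ k) (π : Measure (Fin k → ℝ)) (j : Fin N) (u : ℝ) :
    arrivalLaw N π {p | u < p.1 (p.2.1 j)} = (k : ℝ≥0∞)⁻¹ * ∑ q, π {w | u < w q} := by
  have := isProbabilityMeasure_uniformOn_injective h
  have := isProbabilityMeasure_expMeasure zero_lt_one
  have hunion : {p : Arrival k N | u < p.1 (p.2.1 j)}
      = ⋃ q, {w | u < w q} ×ˢ ({σ | σ j = q} ×ˢ univ) := by
    ext p
    simp
  have hdisj : Pairwise (Function.onFun Disjoint fun q : Fin k =>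
      {w : Fin k → ℝ | u < w q} ×ˢ {σ : Fin N → Fin k | σ j = q} ×ˢ (univ : Set (Fin N → ℝ))) := by
    intro q q' hq
    rw [Function.onFun, disjoint_left]
    rintro p ⟨-, hp, -⟩ ⟨-, hp', -⟩
    exact hq (hp.symm.trans hp')
  rw [hunion, measure_iUnion hdisj fun q => (measurableSet_lt measurable_const
    (measurable_pi_apply q)).prod ((toFinite _).measurableSet.prod MeasurableSet.univ),
    tsum_fintype, Finset.mul_sum]
  refine Finset.sum_congr rfl fun q _ => ?_
  rw [arrivalLaw, Measure.prod_prod, Measure.prod_prod, measure_univ, mul_one,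
    uniformOn_injective_apply_eq h, mul_comm]

lemma ae_pos_requirement (π : Measure (Fin k → ℝ)) (j : Fin N) :
    ∀ᵐ p ∂(arrivalLaw N π), 0 < p.2.2 j := by
  have := isProbabilityMeasure_expMeasure zero_lt_one
  exact Measure.quasiMeasurePreserving_snd.ae (Measure.quasiMeasurePreserving_snd.ae
    ((measurePreserving_eval _ j).quasiMeasurePreserving.ae (ae_pos_expMeasure zero_lt_one)))

variable (π : Measure (Fin k → ℝ)) [IsProbabilityMeasure π]

lemma arrivalLaw_virtualTimes_mem (j : Fin N) {B : Set ℝ} (hB : MeasurableSet B) :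
    arrivalLaw N π {p | virtualTimes p j ∈ B}
      = ∫⁻ u in B, arrivalLaw N π {p | p.1 (p.2.1 j) ≤ u ∧ u < virtualTimes p j} := by
  have hlt : ∀ x : Fin N → ℝ, ∀ u, numOthersBefore x j u < N := fun x u =>
    (Finset.card_filter_le _ _).trans_lt
      ((Finset.card_erase_lt_of_mem (Finset.mem_univ j)).trans_eq (by simp))
  simpa [hlt] using arrivalLaw_virtualTimes_mem_and_lt π j N hB

lemma arrivalLaw_virtualTimes_mem_le_volume (h : N ≤ k) (j : Fin N) {B : Set ℝ}
    (hB : MeasurableSet B) :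
    arrivalLaw N π {p | virtualTimes p j ∈ B} ≤ volume B := by
  have := isProbabilityMeasure_arrivalLaw h π
  rw [arrivalLaw_virtualTimes_mem π j hB]
  exact (lintegral_mono fun u => prob_le_one).trans_eq (by simp)

lemma antitone_measureReal_lt {α : Type*} [MeasurableSpace α] (μ : Measure α) [IsFiniteMeasure μ]
    (f : α → ℝ) : Antitone fun u => μ.real {a | u < f a} :=
  fun _ _ huv => measureReal_mono fun _ ha => huv.trans_lt ha

lemma arrivalLaw_real_lt_virtualTimes_sub (h : N ≤ k) (j : Fin N) {s t : ℝ} (hst : s ≤ t) :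
    (arrivalLaw N π).real {p | s < virtualTimes p j}
        - (arrivalLaw N π).real {p | t < virtualTimes p j}
      = ∫ u in s..t, ((arrivalLaw N π).real {p | u < virtualTimes p j}
        - (arrivalLaw N π).real {p | u < p.1 (p.2.1 j)}) := by
  have := isProbabilityMeasure_arrivalLaw h π
  have hle : ∀ᵐ p ∂(arrivalLaw N π), p.1 (p.2.1 j) ≤ virtualTimes p j :=
    (ae_pos_requirement π j).mono fun p hp => le_add_of_nonneg_right hp.le
  have hmeas : MeasurableSet {z : Arrival k N × ℝ |
      z.1.1 (z.1.2.1 j) ≤ z.2 ∧ z.2 < virtualTimes z.1 j} :=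
    (measurableSet_le ((measurable_workload_apply j).comp measurable_fst) measurable_snd).inter
      (measurableSet_lt measurable_snd ((measurable_virtualTimes_apply j).comp measurable_fst))
  have hpending : ∀ u, (arrivalLaw N π).real {p | p.1 (p.2.1 j) ≤ u ∧ u < virtualTimes p j}
      = (arrivalLaw N π).real {p | u < virtualTimes p j}
        - (arrivalLaw N π).real {p | u < p.1 (p.2.1 j)} := by
    intro u
    rw [eq_sub_iff_add_eq, measureReal_def, measureReal_def, ← ENNReal.toReal_add
      (measure_ne_top _ _) (measure_ne_top _ _),
      measure_le_and_lt_add_measure_lt (measurable_workload_apply j) hle, measureReal_def]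
  have hcross : (arrivalLaw N π).real {p | s < virtualTimes p j}
      - (arrivalLaw N π).real {p | t < virtualTimes p j}
      = (arrivalLaw N π).real {p | virtualTimes p j ∈ Ioc s t} := by
    have hsubset : {p : Arrival k N | t < virtualTimes p j} ⊆ {p | s < virtualTimes p j} :=
      fun p hp => hst.trans_lt hp
    rw [← measureReal_sdiff hsubset
      (measurableSet_lt measurable_const (measurable_virtualTimes_apply j))]
    congr 1
    ext p
    simp
  simp_rw [hcross, ← hpending]
  rw [measureReal_def, arrivalLaw_virtualTimes_mem π j measurableSet_Ioc,
    intervalIntegral.integral_of_le hst]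
  refine (integral_toReal ?_ (Eventually.of_forall fun u => measure_lt_top _ _)).symm
  exact (measurable_measure_prodMk_right hmeas).aemeasurable

end TypicalQueue

lemma IsStationary.arrivalLaw_real_workload_lt {k n m : ℕ} {lam : ℝ} {π : Measure (Fin k → ℝ)}
    (hπ : IsStationary n m lam π) (hn : 1 ≤ n) (hlam : 0 < lam) (hk : n + m ≤ k)
    (j : Fin (n + m)) {s : ℝ} (hs : 0 ≤ s) :
    (arrivalLaw (n + m) π).real {p | s < p.1 (p.2.1 j)} = lam / n * ∑ c ∈ Finset.range n,
      (arrivalLaw (n + m) π).real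
        {p | (Finset.univ.filter fun i => virtualTimes p i ≤ s).card < c + 1} := by
  have := hπ.isProbabilityMeasure
  have := isProbabilityMeasure_arrivalLaw hk π
  have hk0 : (k : ℝ) ≠ 0 := Nat.cast_ne_zero.2 (by lia)
  rw [measureReal_def, arrivalLaw_workload_lt_eq_sum hk, hπ.sum_measure_workload_lt hn hlam hk hs,
    ENNReal.toReal_mul, ENNReal.toReal_mul, ENNReal.toReal_inv, ENNReal.toReal_natCast,
    ENNReal.toReal_ofReal (rate_pos hn hlam hk).le,
    ENNReal.toReal_sum fun _ _ => measure_ne_top _ _]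
  simp only [measureReal_def]
  field_simp

/-! ### Many queues -/

lemma exists_tendsto_probabilityMeasure {Ω ι : Type*} [MeasurableSpace Ω] [TopologicalSpace Ω]
    [OpensMeasurableSpace Ω] {L : Filter ι} {μs : ι → Measure Ω} {μ : Measure Ω}
    [hμ : IsProbabilityMeasure μ] (hprob : ∀ᶠ i in L, IsProbabilityMeasure (μs i))
    (hlim : ∀ f : Ω →ᵇ ℝ, Tendsto (fun i => ∫ x, f x ∂μs i) L (𝓝 (∫ x, f x ∂μ))) :
    ∃ P : ι → ProbabilityMeasure Ω, (∀ᶠ i in L, (P i : Measure Ω) = μs i) ∧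
      Tendsto P L (𝓝 ⟨μ, hμ⟩) := by
  classical
  let P : ι → ProbabilityMeasure Ω := fun i =>
    if h : IsProbabilityMeasure (μs i) then ⟨μs i, h⟩ else ⟨μ, hμ⟩
  have hP : ∀ᶠ i in L, (P i : Measure Ω) = μs i := by
    filter_upwards [hprob] with i hi
    simp [P, hi]
  refine ⟨P, hP, ProbabilityMeasure.tendsto_iff_forall_integral_tendsto.2 fun f => ?_⟩
  refine (hlim f).congr' ?_
  filter_upwards [hP] with i hi
  rw [hi]

lemma tendsto_measureReal_of_tendsto_integral {Ω ι : Type*} [MeasurableSpace Ω]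
    [PseudoEMetricSpace Ω] [OpensMeasurableSpace Ω] {L : Filter ι} {μs : ι → Measure Ω}
    {μ : Measure Ω} [hμ : IsProbabilityMeasure μ] (hprob : ∀ᶠ i in L, IsProbabilityMeasure (μs i))
    (hlim : ∀ f : Ω →ᵇ ℝ, Tendsto (fun i => ∫ x, f x ∂μs i) L (𝓝 (∫ x, f x ∂μ)))
    {S : Set Ω} (hS : μ (frontier S) = 0) :
    Tendsto (fun i => (μs i).real S) L (𝓝 (μ.real S)) := by
  obtain ⟨P, hP, hPlim⟩ := exists_tendsto_probabilityMeasure hprob hlim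
  have h := ProbabilityMeasure.tendsto_measure_of_null_frontier_of_tendsto' hPlim hS
  refine ((ENNReal.tendsto_toReal (measure_ne_top μ S)).comp h).congr' ?_
  filter_upwards [hP] with i hi
  simp [hi, measureReal_def]

lemma measure_isOpen_le_of_tendsto_integral {Ω ι : Type*} [MeasurableSpace Ω]
    [PseudoEMetricSpace Ω] [OpensMeasurableSpace Ω] {L : Filter ι} [L.NeBot] {μs : ι → Measure Ω}
    {μ : Measure Ω} [hμ : IsProbabilityMeasure μ] (hprob : ∀ᶠ i in L, IsProbabilityMeasure (μs i))
    (hlim : ∀ f : Ω →ᵇ ℝ, Tendsto (fun i => ∫ x, f x ∂μs i) L (𝓝 (∫ x, f x ∂μ)))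
    {G : Set Ω} (hG : IsOpen G) {b : ℝ≥0∞} (hb : ∀ᶠ i in L, μs i G ≤ b) : μ G ≤ b := by
  obtain ⟨P, hP, hPlim⟩ := exists_tendsto_probabilityMeasure hprob hlim
  refine (ProbabilityMeasure.le_liminf_measure_open_of_tendsto hPlim hG).trans
    (liminf_le_of_frequently_le' (Eventually.frequently ?_))
  filter_upwards [hP, hb] with i hi hbi
  rwa [hi]

lemma tendsto_integral_pi {ι κ E : Type*} [Fintype κ] [MeasurableSpace E] [PseudoMetricSpace E]
    [SecondCountableTopology E] [BorelSpace E]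
    {L : Filter ι} {μs : ι → κ → Measure E} {μ : Measure E} [hμ : IsProbabilityMeasure μ]
    (hprob : ∀ᶠ i in L, ∀ j, IsProbabilityMeasure (μs i j))
    (hlim : ∀ j, ∀ f : E →ᵇ ℝ, Tendsto (fun i => ∫ x, f x ∂μs i j) L (𝓝 (∫ x, f x ∂μ)))
    (f : (κ → E) →ᵇ ℝ) :
    Tendsto (fun i => ∫ x, f x ∂(Measure.pi (μs i))) L
      (𝓝 (∫ x, f x ∂(Measure.pi fun _ => μ))) := by
  choose P hP hPlim using fun j =>
    exists_tendsto_probabilityMeasure (hprob.mono fun i hi => hi j) (hlim j)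
  have hpi : Tendsto (fun i => ProbabilityMeasure.pi fun j => P j i) L
      (𝓝 (ProbabilityMeasure.pi fun _ => ⟨μ, hμ⟩)) :=
    (ProbabilityMeasure.continuous_pi.tendsto _).comp (tendsto_pi_nhds.2 hPlim)
  refine (ProbabilityMeasure.tendsto_iff_forall_integral_tendsto.1 hpi f).congr' ?_
  filter_upwards [eventually_all.2 hP] with i hi
  simp [hi]

lemma eventually_comap_sigma_fst {ι : Type*} {α : ι → Type*} {l : Filter ι} {P : Sigma α → Prop} :
    (∀ᶠ p in comap Sigma.fst l, P p) ↔ ∀ᶠ i in l, ∀ a, P ⟨i, a⟩ := by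
  rw [eventually_comap]
  refine eventually_congr (Eventually.of_forall fun i => ⟨fun h a => h _ rfl, ?_⟩)
  rintro h ⟨_, a⟩ rfl
  exact h a

section Limit

variable {N : ℕ} {π : (k : ℕ) → Measure (Fin k → ℝ)} {ν : Measure ℝ} [IsProbabilityMeasure ν]

lemma eventually_abs_integral_jointVirtualLaw_sub_lt
    (hπ : ∀ᶠ k in atTop, IsProbabilityMeasure (π k)) (hind : AsymptoticallyIndependent N π)
    (hν : IsLimitVirtualLaw π ν) (f : (Fin N → ℝ) →ᵇ ℝ) {ε : ℝ} (hε : 0 < ε) :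
    ∀ᶠ k in atTop, ∀ σ : Fin N → Fin k, Function.Injective σ →
      |∫ x, f x ∂(jointVirtualLaw (π k) σ) - ∫ x, f x ∂(Measure.pi fun _ => ν)| < ε := by
  -- Convergence along `l` is convergence in the number of queues, uniformly in their choice.
  let l : Filter (Σ k, Fin N → Fin k) := comap Sigma.fst atTop
  have hprob : ∀ᶠ p in l, ∀ j, IsProbabilityMeasure (virtualLaw (π p.1) (p.2 j)) := by
    have := isProbabilityMeasure_expMeasure zero_lt_one
    refine eventually_comap_sigma_fst.2 (hπ.mono fun k hk σ j => ?_)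
    exact Measure.isProbabilityMeasure_map (by fun_prop)
  have hmarginal : ∀ j, ∀ g : ℝ →ᵇ ℝ, Tendsto
      (fun p : Σ k, Fin N → Fin k => ∫ x, g x ∂(virtualLaw (π p.1) (p.2 j))) l
      (𝓝 (∫ x, g x ∂ν)) := fun j g => Metric.tendsto_nhds.2 fun δ hδ =>
    eventually_comap_sigma_fst.2 ((hν g δ hδ).mono fun k hk σ => hk (σ j))
  have hproduct := eventually_comap_sigma_fst.1
    (Metric.tendsto_nhds.1 (tendsto_integral_pi hprob hmarginal f) (ε / 2) (half_pos hε))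
  filter_upwards [hind f (ε / 2) (half_pos hε), hproduct] with k hk hk' σ hσ
  exact (abs_sub_le _ _ _).trans_lt ((add_lt_add (hk σ hσ) (hk' σ)).trans_eq (add_halves ε))

lemma integral_virtualTimes {k : ℕ} (h : N ≤ k) (π : Measure (Fin k → ℝ)) [IsProbabilityMeasure π]
    (f : (Fin N → ℝ) →ᵇ ℝ) :
    ∫ p, f (virtualTimes p) ∂(arrivalLaw N π) = ∫ σ, ∫ x, f x ∂(jointVirtualLaw π σ)
      ∂(uniformOn {σ : Fin N → Fin k | Function.Injective σ}) := by
  have := isProbabilityMeasure_uniformOn_injective h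
  have := isProbabilityMeasure_expMeasure zero_lt_one
  set U := uniformOn {σ : Fin N → Fin k | Function.Injective σ}
  set E := Measure.pi fun _ : Fin N => expMeasure 1
  have hmp : MeasurePreserving (fun p : (Fin N → Fin k) × (Fin k → ℝ) × (Fin N → ℝ) =>
      (p.2.1, p.1, p.2.2)) (U.prod (π.prod E)) (arrivalLaw N π) :=
    (measurePreserving_prodAssoc π U E).comp
      (((Measure.measurePreserving_swap (μ := U) (ν := π)).prod (MeasurePreserving.id E)).comp
        ((measurePreserving_prodAssoc U π E).symm MeasurableEquiv.prodAssoc))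
  have hf : StronglyMeasurable fun p : Arrival k N => f (virtualTimes p) :=
    (f.continuous.measurable.comp measurable_virtualTimes).stronglyMeasurable
  rw [← hmp.map_eq, integral_map hmp.measurable.aemeasurable hf.aestronglyMeasurable,
    integral_prod]
  · refine integral_congr_ae (Eventually.of_forall fun σ => ?_)
    simp only [jointVirtualLaw]
    rw [integral_map]
    · rfl
    · fun_prop
    · exact f.continuous.aestronglyMeasurable
  · exact Integrable.of_bound (hf.comp_measurable hmp.measurable).aestronglyMeasurable ‖f‖
      (Eventually.of_forall fun p => f.norm_coe_le_norm _)

lemma tendsto_integral_virtualTimes (hπ : ∀ᶠ k in atTop, IsProbabilityMeasure (π k))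
    (hind : AsymptoticallyIndependent N π) (hν : IsLimitVirtualLaw π ν) (f : (Fin N → ℝ) →ᵇ ℝ) :
    Tendsto (fun k => ∫ x, f x ∂((arrivalLaw N (π k)).map virtualTimes)) atTop
      (𝓝 (∫ x, f x ∂(Measure.pi fun _ => ν))) := by
  refine Metric.tendsto_nhds.2 fun ε hε => ?_
  filter_upwards [eventually_abs_integral_jointVirtualLaw_sub_lt hπ hind hν f (half_pos hε), hπ,
    eventually_ge_atTop N] with k hk hprob hkN
  have := isProbabilityMeasure_uniformOn_injective hkN
  set U := uniformOn {σ : Fin N → Fin k | Function.Injective σ}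
  set L := ∫ x, f x ∂(Measure.pi fun _ => ν)
  have hmean : ∫ x, f x ∂((arrivalLaw N (π k)).map virtualTimes) - L
      = ∫ σ, (∫ x, f x ∂(jointVirtualLaw (π k) σ) - L) ∂U := by
    rw [integral_map measurable_virtualTimes.aemeasurable f.continuous.aestronglyMeasurable,
      integral_virtualTimes hkN, integral_sub Integrable.of_finite Integrable.of_finite,
      integral_const, probReal_univ, one_smul]
  have hbound : ∀ᵐ σ ∂U, ‖∫ x, f x ∂(jointVirtualLaw (π k) σ) - L‖ ≤ ε / 2 :=
    ae_uniformOn_injective.mono fun σ hσ => (hk σ hσ).le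
  rw [dist_eq_norm, hmean]
  refine (norm_integral_le_of_norm_le_const hbound).trans_lt ?_
  rw [probReal_univ, mul_one]
  exact half_lt_self hε

lemma eventually_isProbabilityMeasure_virtualTimes
    (hπ : ∀ᶠ k in atTop, IsProbabilityMeasure (π k)) :
    ∀ᶠ k in atTop, IsProbabilityMeasure ((arrivalLaw N (π k)).map virtualTimes) := by
  filter_upwards [hπ, eventually_ge_atTop N] with k hk hkN
  have := isProbabilityMeasure_arrivalLaw hkN (π k)
  exact Measure.isProbabilityMeasure_map measurable_virtualTimes.aemeasurable

lemma measure_Ioo_le_of_isLimitVirtualLaw (hN : 0 < N)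
    (hπ : ∀ᶠ k in atTop, IsProbabilityMeasure (π k))
    (hind : AsymptoticallyIndependent N π) (hν : IsLimitVirtualLaw π ν) (a b : ℝ) :
    ν (Ioo a b) ≤ ENNReal.ofReal (b - a) := by
  let j : Fin N := ⟨0, hN⟩
  have hcoord : MeasurePreserving (fun x : Fin N → ℝ => x j) (Measure.pi fun _ => ν) ν :=
    measurePreserving_eval _ j
  rw [← hcoord.measure_preimage measurableSet_Ioo.nullMeasurableSet]
  refine measure_isOpen_le_of_tendsto_integral (eventually_isProbabilityMeasure_virtualTimes hπ)
    (tendsto_integral_virtualTimes hπ hind hν) (isOpen_Ioo.preimage (continuous_apply j)) ?_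
  filter_upwards [hπ, eventually_ge_atTop N] with k hk hkN
  rw [Measure.map_apply measurable_virtualTimes (measurableSet_Ioo.preimage hcoord.measurable)]
  exact (arrivalLaw_virtualTimes_mem_le_volume (π k) hkN j measurableSet_Ioo).trans_eq
    Real.volume_Ioo

end Limit

/-! ### The limit equation -/

section LimitEquation

variable {N : ℕ} {π : (k : ℕ) → Measure (Fin k → ℝ)} {ν : Measure ℝ} [IsProbabilityMeasure ν]

lemma nullSingletonClass_of_measure_Ioo_le {μ : Measure ℝ}
    (h : ∀ a b, μ (Ioo a b) ≤ ENNReal.ofReal (b - a)) : NullSingletonClass μ := by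
  refine ⟨fun x => nonpos_iff_eq_zero.1 ?_⟩
  have hlim : Tendsto (fun ε : ℝ => ENNReal.ofReal ((x + ε) - (x - ε))) (𝓝[>] 0) (𝓝 0) := by
    have hcont : Continuous fun ε : ℝ => ENNReal.ofReal ((x + ε) - (x - ε)) :=
      ENNReal.continuous_ofReal.comp (by fun_prop)
    simpa using (hcont.tendsto 0).mono_left nhdsWithin_le_nhds
  refine ge_of_tendsto hlim ?_
  filter_upwards [self_mem_nhdsWithin] with ε hε
  refine (measure_mono (singleton_subset_iff.2 ?_)).trans (h _ _)
  exact ⟨sub_lt_self x hε, lt_add_of_pos_right x hε⟩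

lemma tendsto_real_Ioi_atTop : Tendsto (fun t => ν.real (Ioi t)) atTop (𝓝 0) := by
  simpa [cdf_eq_real, ← probReal_compl_eq_one_sub measurableSet_Iic]
    using (tendsto_cdf_atTop ν).const_sub 1

lemma continuous_real_Ioi [NullSingletonClass ν] : Continuous fun t => ν.real (Ioi t) := by
  refine continuous_iff_continuousAt.2 fun t => ?_
  have h : ContinuousOn (fun s => ∫ _ in Ioi s, (1 : ℝ) ∂ν) (Ici (t - 1)) :=
    IntegrableOn.continuousOn_Ici_primitive_Ioi (integrable_const 1)
  simpa using h.continuousAt (Ici_mem_nhds (sub_one_lt t))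

lemma tendsto_arrivalLaw_real_virtualTimes_mem (hπ : ∀ᶠ k in atTop, IsProbabilityMeasure (π k))
    (hind : AsymptoticallyIndependent N π) (hν : IsLimitVirtualLaw π ν) {S : Set (Fin N → ℝ)}
    (hS : MeasurableSet S) (hfrontier : (Measure.pi fun _ => ν) (frontier S) = 0) :
    Tendsto (fun k => (arrivalLaw N (π k)).real {p | virtualTimes p ∈ S}) atTop
      (𝓝 ((Measure.pi fun _ => ν).real S)) := by
  refine (tendsto_measureReal_of_tendsto_integral (eventually_isProbabilityMeasure_virtualTimes hπ)
    (tendsto_integral_virtualTimes hπ hind hν) hfrontier).congr fun k => ?_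
  rw [map_measureReal_apply measurable_virtualTimes hS]
  rfl

variable [NullSingletonClass ν]

lemma tendsto_arrivalLaw_real_card_lt (hπ : ∀ᶠ k in atTop, IsProbabilityMeasure (π k))
    (hind : AsymptoticallyIndependent N π) (hν : IsLimitVirtualLaw π ν) (c : ℕ) (t : ℝ) :
    Tendsto (fun k => (arrivalLaw N (π k)).real
        {p | (Finset.univ.filter fun i => virtualTimes p i ≤ t).card < c}) atTop
      (𝓝 (binomTail N c (ν.real (Ioi t)))) := by
  have h := tendsto_arrivalLaw_real_virtualTimes_mem hπ hind hν
    (measurableSet_card_filter_le_lt Finset.univ measurable_pi_apply measurable_const c)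
    (pi_frontier_setOf_card_filter_le_lt ν Finset.univ t c)
  rwa [pi_real_card_filter_le_lt, Fintype.card_fin] at h

lemma tendsto_arrivalLaw_real_lt_virtualTimes (hπ : ∀ᶠ k in atTop, IsProbabilityMeasure (π k))
    (hind : AsymptoticallyIndependent N π) (hν : IsLimitVirtualLaw π ν) (j : Fin N) (t : ℝ) :
    Tendsto (fun k => (arrivalLaw N (π k)).real {p | t < virtualTimes p j}) atTop
      (𝓝 (ν.real (Ioi t))) := by
  have hcoord : MeasurePreserving (fun x : Fin N → ℝ => x j) (Measure.pi fun _ => ν) ν :=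
    measurePreserving_eval _ j
  have hcont : Continuous fun x : Fin N → ℝ => x j := continuous_apply j
  have hfrontier : (Measure.pi fun _ => ν) (frontier ((fun x => x j) ⁻¹' Ioi t)) = 0 := by
    refine measure_mono_null (hcont.frontier_preimage_subset (Ioi t)) ?_
    exact hcoord.quasiMeasurePreserving.preimage_null (by rw [frontier_Ioi, measure_singleton])
  rw [← hcoord.measureReal_preimage measurableSet_Ioi.nullMeasurableSet]
  exact tendsto_arrivalLaw_real_virtualTimes_mem hπ hind hν
    (hcoord.measurable measurableSet_Ioi) hfrontier

end LimitEquation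

section Stationary

variable {n m : ℕ} {lam : ℝ} {π : (k : ℕ) → Measure (Fin k → ℝ)} {ν : Measure ℝ}
  [IsProbabilityMeasure ν]

lemma tendsto_completionLaw_real_Ioi [NullSingletonClass ν] (hn : 1 ≤ n)
    (hπ : ∀ᶠ k in atTop, IsProbabilityMeasure (π k))
    (hind : AsymptoticallyIndependent (n + m) π) (hν : IsLimitVirtualLaw π ν) (t : ℝ) :
    Tendsto (fun k => (completionLaw n m (π k)).real (Ioi t)) atTop
      (𝓝 (binomTail (n + m) n (ν.real (Ioi t)))) := by
  refine (tendsto_arrivalLaw_real_card_lt hπ hind hν n t).congr fun k => ?_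
  rw [completionLaw, map_measureReal_apply
    (measurable_completionTime hn (Nat.le_add_right n m)) measurableSet_Ioi]
  simp only [← lt_orderStat_iff hn (Nat.le_add_right n m)]
  rfl

lemma eventually_isProbabilityMeasure_of_isStationary
    (hstat : ∀ k, n + m ≤ k → IsStationary n m lam (π k)) :
    ∀ᶠ k in atTop, IsProbabilityMeasure (π k) :=
  eventually_atTop.2 ⟨n + m, fun k hk => (hstat k hk).isProbabilityMeasure⟩

variable [NullSingletonClass ν]

lemma real_Ioi_zero (hn : 1 ≤ n) (hstat : ∀ k, n + m ≤ k → IsStationary n m lam (π k))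
    (hind : AsymptoticallyIndependent (n + m) π) (hν : IsLimitVirtualLaw π ν) :
    ν.real (Ioi 0) = 1 := by
  have hπ := eventually_isProbabilityMeasure_of_isStationary hstat
  let j : Fin (n + m) := ⟨0, by omega⟩
  refine tendsto_nhds_unique (tendsto_arrivalLaw_real_lt_virtualTimes hπ hind hν j 0)
    (tendsto_const_nhds.congr' ?_)
  filter_upwards [hπ, eventually_ge_atTop (n + m)] with k hk hkN
  have := isProbabilityMeasure_arrivalLaw hkN (π k)
  have hpos : ∀ᵐ p ∂(arrivalLaw (n + m) (π k)), 0 < virtualTimes p j := by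
    filter_upwards [(measurePreserving_fst_arrivalLaw hkN (π k)).quasiMeasurePreserving.ae
      (hstat k hkN).nonneg, ae_pos_requirement (π k) j] with p hw he
    exact add_pos_of_nonneg_of_pos (hw _) he
  rw [measureReal_def, (mem_ae_iff_prob_eq_one (measurableSet_lt measurable_const
    (measurable_virtualTimes_apply j))).1 hpos, ENNReal.toReal_one]

lemma tendsto_arrivalLaw_real_workload_lt (hn : 1 ≤ n) (hm : 1 ≤ m) (hlam : 0 < lam)
    (hstat : ∀ k, n + m ≤ k → IsStationary n m lam (π k))
    (hind : AsymptoticallyIndependent (n + m) π) (hν : IsLimitVirtualLaw π ν)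
    (j : Fin (n + m)) {t : ℝ} (ht : 0 ≤ t) :
    Tendsto (fun k => (arrivalLaw (n + m) (π k)).real {p | t < p.1 (p.2.1 j)}) atTop
      (𝓝 (lam * ((m : ℝ) + n) / n * binomTailPrimitive n m (ν.real (Ioi t)))) := by
  have hlim := (tendsto_finsetSum (Finset.range n) fun c _ => tendsto_arrivalLaw_real_card_lt
    (eventually_isProbabilityMeasure_of_isStationary hstat) hind hν (c + 1) t).const_mul (lam / n)
  rw [sum_binomTail_succ_eq hn hm] at hlim
  rw [show lam * ((m : ℝ) + n) / n * binomTailPrimitive n m (ν.real (Ioi t))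
    = lam / n * (((n : ℝ) + m) * binomTailPrimitive n m (ν.real (Ioi t))) by ring]
  refine hlim.congr' ?_
  filter_upwards [eventually_ge_atTop (n + m)] with k hk
  exact ((hstat k hk).arrivalLaw_real_workload_lt hn hlam hk j ht).symm

lemma real_Ioi_sub_eq_integral (hn : 1 ≤ n) (hm : 1 ≤ m) (hlam : 0 < lam)
    (hstat : ∀ k, n + m ≤ k → IsStationary n m lam (π k))
    (hind : AsymptoticallyIndependent (n + m) π) (hν : IsLimitVirtualLaw π ν)
    {s t : ℝ} (hs : 0 ≤ s) (hst : s ≤ t) :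
    ν.real (Ioi s) - ν.real (Ioi t) = ∫ u in s..t, (ν.real (Ioi u)
      - lam * ((m : ℝ) + n) / n * binomTailPrimitive n m (ν.real (Ioi u))) := by
  have hπ := eventually_isProbabilityMeasure_of_isStationary hstat
  let j : Fin (n + m) := ⟨0, by omega⟩
  let F : ℕ → ℝ → ℝ := fun k u => (arrivalLaw (n + m) (π k)).real {p | u < virtualTimes p j}
    - (arrivalLaw (n + m) (π k)).real {p | u < p.1 (p.2.1 j)}
  have hF : ∀ᶠ k in atTop, IsProbabilityMeasure (arrivalLaw (n + m) (π k)) := by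
    filter_upwards [hπ, eventually_ge_atTop (n + m)] with k hk hkN
    exact isProbabilityMeasure_arrivalLaw hkN (π k)
  have hleft : Tendsto (fun k => ∫ u in s..t, F k u) atTop
      (𝓝 (ν.real (Ioi s) - ν.real (Ioi t))) := by
    refine ((tendsto_arrivalLaw_real_lt_virtualTimes hπ hind hν j s).sub
      (tendsto_arrivalLaw_real_lt_virtualTimes hπ hind hν j t)).congr' ?_
    filter_upwards [hπ, eventually_ge_atTop (n + m)] with k hk hkN
    exact arrivalLaw_real_lt_virtualTimes_sub (π k) hkN j hst
  refine tendsto_nhds_unique hleft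
    (intervalIntegral.tendsto_integral_filter_of_dominated_convergence (fun _ => 1) ?_ ?_
      intervalIntegrable_const ?_)
  · filter_upwards [hF] with k hk
    exact ((antitone_measureReal_lt _ _).measurable.sub
      (antitone_measureReal_lt _ _).measurable).aestronglyMeasurable
  · filter_upwards [hF] with k hk
    refine Eventually.of_forall fun u _ => ?_
    exact abs_sub_le_of_nonneg_of_le measureReal_nonneg measureReal_le_one measureReal_nonneg
      measureReal_le_one
  · refine Eventually.of_forall fun u hu => ?_
    rw [uIoc_of_le hst] at hu
    exact (tendsto_arrivalLaw_real_lt_virtualTimes hπ hind hν j u).sub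
      (tendsto_arrivalLaw_real_workload_lt hn hm hlam hstat hind hν j (hs.trans hu.1.le))

lemma hasDerivWithinAt_real_Ioi (hn : 1 ≤ n) (hm : 1 ≤ m) (hlam : 0 < lam)
    (hstat : ∀ k, n + m ≤ k → IsStationary n m lam (π k))
    (hind : AsymptoticallyIndependent (n + m) π) (hν : IsLimitVirtualLaw π ν)
    {t : ℝ} (ht : 0 ≤ t) :
    HasDerivWithinAt (fun s => ν.real (Ioi s)) (-ν.real (Ioi t)
      + lam * ((m : ℝ) + n) / n * binomTailPrimitive n m (ν.real (Ioi t))) (Ici 0) t := by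
  set G : ℝ → ℝ := fun u => ν.real (Ioi u)
    - lam * ((m : ℝ) + n) / n * binomTailPrimitive n m (ν.real (Ioi u))
  have hG : Continuous G := continuous_real_Ioi.sub
    (continuous_const.mul ((continuous_binomTailPrimitive n m).comp continuous_real_Ioi))
  have heq : ∀ u ∈ Ici (0 : ℝ), ν.real (Ioi u) = ν.real (Ioi 0) - ∫ v in (0 : ℝ)..u, G v :=
    fun u hu => by
      rw [← real_Ioi_sub_eq_integral hn hm hlam hstat hind hν le_rfl hu, sub_sub_cancel]
  exact (((hG.integral_hasStrictDerivAt 0 t).hasDerivAt.const_sub _).hasDerivWithinAt.congr heq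
    (heq t ht)).congr_deriv (by ring)

end Stationary

lemma lt_one_of_hasDerivWithinAt {n m : ℕ} (hn : 1 ≤ n) (hm : 1 ≤ m) {lam : ℝ} {H : ℝ → ℝ}
    (hH0 : ∀ t, 0 ≤ H t) (hH1 : ∀ t, H t ≤ 1) (hlim : Tendsto H atTop (𝓝 0)) (hzero : H 0 = 1)
    (hode : ∀ t, 0 ≤ t → HasDerivWithinAt H
      (-H t + lam * ((m : ℝ) + n) / n * binomTailPrimitive n m (H t)) (Ici 0) t) : lam < 1 := by
  by_contra! hlam
  have hone : ∀ t, 0 ≤ t → H t = 1 := fun t ht => by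
    refine eq_one_of_le_deriv (α := lam * ((m : ℝ) + n) / n) hode hH1 hzero (fun u _ => ?_) ht
    have h := mul_le_mul_of_nonneg_left
      (div_sub_one_sub_le_binomTailPrimitive hn hm (hH0 u) (hH1 u))
      (show 0 ≤ lam * ((m : ℝ) + n) / n by positivity)
    have hcancel : lam * ((m : ℝ) + n) / n * (n / ((n : ℝ) + m)) = lam := by
      field_simp
      ring
    rw [mul_sub, hcancel] at h
    linarith [hH1 u]
  refine zero_ne_one (tendsto_nhds_unique hlim (tendsto_const_nhds.congr' ?_))
  filter_upwards [eventually_ge_atTop 0] with t ht using (hone t ht).symm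

lemma exists_exp_mul_le_of_hasDerivWithinAt {n m : ℕ} (hn : 1 ≤ n) (hm : 1 ≤ m) {α : ℝ}
    (hα : 0 ≤ α) {H : ℝ → ℝ} (hH0 : ∀ t, 0 ≤ H t) (hH1 : ∀ t, H t ≤ 1)
    (hlim : Tendsto H atTop (𝓝 0))
    (hode : ∀ t, 0 ≤ t → HasDerivWithinAt H
      (-H t + α * binomTailPrimitive n m (H t)) (Ici 0) t) :
    ∃ C, ∀ᶠ t in atTop, Real.exp t * H t ≤ C := by
  obtain ⟨K, hK0, hK⟩ := exists_binomTailPrimitive_le_sq hn hm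
  refine exists_exp_mul_le_of_deriv_le (mul_nonneg hα hK0) hode hH0 hlim fun t _ => ?_
  rw [mul_assoc]
  gcongr
  exact hK _ (hH0 t) (hH1 t)

/-! ### Tails of the completion times -/

lemma exp_neg_le_replicationTail {lam : ℝ} (h0 : 0 ≤ lam) (h1 : lam ≤ 1) {n d : ℕ} (hn : 1 ≤ n)
    (hd : 2 ≤ d) {t : ℝ} (ht : 0 ≤ t) : Real.exp (-(d * t)) ≤ replicationTail lam n d t := by
  have hd1 : (0 : ℝ) < (d : ℝ) - 1 := sub_pos.2 (Nat.one_lt_cast.2 hd)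
  set x := Real.exp (t * ((d : ℝ) - 1))
  set D := lam + (1 - lam) * x
  set p := (d : ℝ) / ((d : ℝ) - 1)
  have hp : 0 ≤ p := by positivity
  have hx : 1 ≤ x := Real.one_le_exp (by positivity)
  have hD1 : 1 ≤ D := by nlinarith
  have hDx : D ≤ x := by nlinarith
  have hle : Real.exp (-(d * t)) ≤ (1 / D) ^ p := calc
    Real.exp (-(d * t)) = (1 / x) ^ p := by
      rw [one_div, ← Real.exp_neg, ← Real.exp_mul]
      congr 1
      simp only [p]
      field_simp
    _ ≤ (1 / D) ^ p := by gcongr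
  have hle1 : (1 / D) ^ p ≤ 1 :=
    Real.rpow_le_one (by positivity) ((div_le_one (by positivity)).2 hD1) hp
  have hpow : (1 - (1 / D) ^ p) ^ n ≤ 1 - (1 / D) ^ p :=
    pow_le_of_le_one (sub_nonneg.2 hle1) (sub_le_self 1 (by positivity)) (by omega)
  rw [replicationTail]
  linarith

lemma isLittleO_replicationTail {f : ℝ → ℝ} {a C : ℝ} (hf : ∀ t, 0 ≤ f t)
    (hfC : ∀ᶠ t in atTop, Real.exp (a * t) * f t ≤ C) {lam : ℝ} (h0 : 0 ≤ lam) (h1 : lam ≤ 1)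
    {n d : ℕ} (hn : 1 ≤ n) (hd : 2 ≤ d) (hda : d < a) : f =o[atTop] replicationTail lam n d := by
  have hexp : f =O[atTop] fun t => Real.exp (-(a * t)) := by
    refine IsBigO.of_bound C (hfC.mono fun t ht => ?_)
    rwa [Real.norm_of_nonneg (hf t), Real.norm_of_nonneg (Real.exp_pos _).le, Real.exp_neg,
      ← div_eq_mul_inv, le_div_iff₀ (Real.exp_pos _), mul_comm]
  have hrate : (fun t => Real.exp (-(a * t))) =o[atTop] fun t => Real.exp (-(d * t)) := by
    rw [Real.isLittleO_exp_comp_exp_comp]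
    refine (tendsto_id.const_mul_atTop (sub_pos.2 hda)).congr fun t => ?_
    simp only [id]
    ring
  have hrep : (fun t => Real.exp (-(d * t))) =O[atTop] replicationTail lam n d := by
    refine IsBigO.of_bound 1 ?_
    filter_upwards [eventually_ge_atTop 0] with t ht
    rw [one_mul, Real.norm_of_nonneg (Real.exp_pos _).le]
    exact (exp_neg_le_replicationTail h0 h1 hn hd ht).trans (le_abs_self _)
  exact (hexp.trans_isLittleO hrate).trans_isBigO hrep

lemma exists_exp_mul_binomTail_le {n : ℕ} (hn : 1 ≤ n) (m : ℕ) {H : ℝ → ℝ} {C : ℝ}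
    (hH0 : ∀ t, 0 ≤ H t) (hH1 : ∀ t, H t ≤ 1) (hC : ∀ᶠ t in atTop, Real.exp t * H t ≤ C) :
    ∃ C', ∀ᶠ t in atTop,
      Real.exp (((m : ℝ) + 1) * t) * binomTail (n + m) n (H t) ≤ C' := by
  obtain ⟨K, hK0, hK⟩ := exists_binomTail_le hn m
  refine ⟨K * C ^ (m + 1), hC.mono fun t ht => ?_⟩
  have hexp : Real.exp (((m : ℝ) + 1) * t) = Real.exp t ^ (m + 1) := by
    rw [← Real.exp_nat_mul]
    push_cast
    rfl
  calc Real.exp (((m : ℝ) + 1) * t) * binomTail (n + m) n (H t)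
      ≤ Real.exp (((m : ℝ) + 1) * t) * (K * H t ^ (m + 1)) := by
        gcongr
        exact hK _ (hH0 t) (hH1 t)
    _ = K * (Real.exp t * H t) ^ (m + 1) := by
        rw [hexp]
        ring
    _ ≤ K * C ^ (m + 1) := by
        have := mul_nonneg (Real.exp_pos t).le (hH0 t)
        gcongr

lemma limsup_ofReal_mul_measure_lt_top {Ω : Type*} [MeasurableSpace Ω] {μ : Measure Ω}
    [IsFiniteMeasure μ] {f : ℝ → ℝ} {S : ℝ → Set Ω} {C : ℝ} (hf : ∀ t, 0 ≤ f t)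
    (h : ∀ᶠ t in atTop, f t * μ.real (S t) ≤ C) :
    limsup (fun t => ENNReal.ofReal (f t) * μ (S t)) atTop < ⊤ := by
  refine lt_of_le_of_lt (limsup_le_of_le (by isBoundedDefault) ?_) (ENNReal.ofReal_lt_top (r := C))
  filter_upwards [h] with t ht
  rw [← ofReal_measureReal, ← ENNReal.ofReal_mul (hf t)]
  exact ENNReal.ofReal_le_ofReal ht

end MDSQueue

theorem theorem1 (n m : ℕ) (hn : 1 ≤ n) (hm : 1 ≤ m) (lam : ℝ) (hlam : 0 < lam)
    (π : (k : ℕ) → Measure (Fin k → ℝ))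
    (hstat : ∀ k, n + m ≤ k → MDSQueue.IsStationary n m lam (π k))
    (hind : MDSQueue.AsymptoticallyIndependent (n + m) π)
    (ν : Measure ℝ) [IsProbabilityMeasure ν] (hν : MDSQueue.IsLimitVirtualLaw π ν) :
    -- the differential equation for `P (V > t)`, one-sided at `t = 0`
    (∀ t : ℝ, 0 ≤ t →
      HasDerivWithinAt (fun s : ℝ => ν.real (Ioi s))
        (-(ν.real (Ioi t))
          + (lam * ((m : ℝ) + n) / n) * ((n : ℝ) + m - 1) * ((n + m - 2).choose (n - 1) : ℝ)
            * ∑ i ∈ Finset.range n, ((n - 1).choose i : ℝ) * (-1) ^ i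
              * (1 / (((m : ℝ) + i) * ((m : ℝ) + i + 1))) * (ν.real (Ioi t)) ^ (m + i + 1))
        (Ici 0) t) ∧
    limsup (fun t : ℝ => ENNReal.ofReal (Real.exp t) * ν (Ioi t)) atTop < ⊤ ∧
    -- `γ` is the law of the batch completion time in the limit of many queues
    ∃ γ : Measure ℝ, IsProbabilityMeasure γ ∧
      (∀ t : ℝ, Tendsto (fun k => (MDSQueue.completionLaw n m (π k)).real (Ioi t)) atTop
        (𝓝 (γ.real (Ioi t)))) ∧
      γ = (Measure.pi fun _ : Fin (n + m) => ν).map (MDSQueue.orderStat n) ∧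
      (∀ t : ℝ, γ.real (Ioi t)
        = ((n : ℝ) + m) * ((n + m - 1).choose (n - 1) : ℝ)
          * ∑ i ∈ Finset.range n, ((n - 1).choose i : ℝ) * (-1) ^ i
            * (1 / ((m : ℝ) + i + 1)) * (ν.real (Ioi t)) ^ (m + i + 1)) ∧
      limsup (fun t : ℝ => ENNReal.ofReal (Real.exp (((m : ℝ) + 1) * t)) * γ (Ioi t)) atTop < ⊤ ∧
      ∀ d : ℕ, 2 ≤ d → d ≤ m →
        (fun t : ℝ => γ.real (Ioi t)) =o[atTop] MDSQueue.replicationTail lam n d := by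
  have hπ := MDSQueue.eventually_isProbabilityMeasure_of_isStationary hstat
  have := MDSQueue.nullSingletonClass_of_measure_Ioo_le
    (MDSQueue.measure_Ioo_le_of_isLimitVirtualLaw (by omega) hπ hind hν)
  have hH0 : ∀ t, 0 ≤ ν.real (Ioi t) := fun _ => measureReal_nonneg
  have hH1 : ∀ t, ν.real (Ioi t) ≤ 1 := fun _ => measureReal_le_one
  have hode := fun t => MDSQueue.hasDerivWithinAt_real_Ioi hn hm hlam hstat hind hν (t := t)
  have hlam1 : lam < 1 := MDSQueue.lt_one_of_hasDerivWithinAt hn hm hH0 hH1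
    MDSQueue.tendsto_real_Ioi_atTop (MDSQueue.real_Ioi_zero hn hstat hind hν) hode
  obtain ⟨C, hC⟩ := MDSQueue.exists_exp_mul_le_of_hasDerivWithinAt hn hm (by positivity) hH0 hH1
    MDSQueue.tendsto_real_Ioi_atTop hode
  obtain ⟨C', hC'⟩ := MDSQueue.exists_exp_mul_binomTail_le hn m hH0 hH1 hC
  have hγ := MDSQueue.pi_map_orderStat_real_Ioi hn (Nat.le_add_right n m) ν
  simp_rw [← hγ] at hC'
  refine ⟨fun t ht => (hode t ht).congr_deriv (by rw [MDSQueue.binomTailPrimitive]; ring),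
    MDSQueue.limsup_ofReal_mul_measure_lt_top (fun t => (Real.exp_pos t).le) hC, _,
    Measure.isProbabilityMeasure_map
      (MDSQueue.measurable_orderStat hn (Nat.le_add_right n m)).aemeasurable,
    fun t => ?_, rfl, fun t => ?_,
    MDSQueue.limsup_ofReal_mul_measure_lt_top (fun t => (Real.exp_pos _).le) hC',
    fun d hd hdm => MDSQueue.isLittleO_replicationTail (fun _ => measureReal_nonneg) hC'
      hlam.le hlam1.le hn hd (by exact_mod_cast Nat.lt_succ_of_le hdm)⟩
  · rw [hγ]
    exact MDSQueue.tendsto_completionLaw_real_Ioi hn hπ hind hν t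
  · rw [hγ, MDSQueue.binomTail_eq_incompleteBeta hn]
    rfl
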